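/- Let $N\ge 1$ and let $h$ be a complex polynomial of degree $N$ (for example $h(x)=x^N$). Every polynomial $p$ has a unique expansion $p(x)=\sum_{j=0}^{N-1}\sum_{n}a_{j,n}x^j h(x)^n$; put $R_{h,N,j}(p)(x)=\sum_n a_{j,n}x^n$, so that $p(x)=\sum_{j=0}^{N-1}x^jR_{h,N,j}(p)(h(x))$. (For $h=x^N$, $R_{N,j}(p)(x)=\sum_n \frac{p^{(nN+j)}(0)}{(nN+j)!}x^n$.) We say that a sequence of polynomials $(p_n)_{n\ge0}$ satisfies a symmetric $(2N+1)$-term recurrence with coefficients $(c_{n,k})$ if $p_k$ has degree $k$ for $0\le k\le N-1$, $p_k=0$ for $k<0$, $c_{n,0}\in\mathbb R$, $c_{n,k}\in\mathbb C$ for $1\le k\le N$, $c_{n,N}\ne0$ for all $n$, and $$h\,p_n=c_{n,0}p_n+\sum_{k=1}^N\left(\overline{c_{n,k}}\,p_{n-k}+c_{n+k,k}\,p_{n+k}\right)\qquad(n\ge 0).$$ We say that a sequence $(P_n)_{n\ge0}$ of $N\times N$ matrix polynomials satisfies a matrix three-term recurrence with coefficients $(D_n)_{n\ge1}$, $(E_n)_{n\ge0}$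 in $\mathbb C^{N\times N}$ if $P_{-1}=0$, $P_0$ is a nonsingular constant matrix, $E_n^*=E_n$, $\det D_n\neq0$, and $$xP_n=D_{n+1}P_{n+1}+E_nP_n+D_n^*P_{n-1}\qquad(n\ge0).$$ A positive definite matrix of measures is a matrix $\mathbf M=(\mu_{k,l})$ of complex Borel measures on $\mathbb R$ with finite moments of all orders such that $\mathbf M(B)$ is positive semidefinite for every Borel set $B$. A sequence $(P_n)$ of matrix polynomials, $P_n$ of degree at most $n$, is orthonormal with respect to $\mathbf M$ if $\int P_n\,d\mathbf M\,P_m^*=\delta_{n,m}I$ for all $n,m$ (the leading coefficients, i.e. the coefficients of $x^n$ in $P_n$, are then nonsingular). **Theorem.** (1) Let $(p_n)$ satisfy a symmetric $(2N+1)$-term recurrence with coefficients $(c_{n,k})$, and let $P_n$ be the matrix polynomial with entries $(P_n)_{m,j}=R_{h,N,j}(p_{nN+m})$, $0\le m,j\le N-1$. Then $\deg p_n=n$ for all $n$; $(P_n)$ satisfies the matrix three-term recurrence with the coefficients $$(D_n)_{i,l}=\begin{cases}0,& i<l,\\ c_{nN+l,\,N+l-i},& i\ge l,\end{cases}\qquad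 (E_n)_{i,l}=\begin{cases}c_{nN+l,\,l-i},& i\le l,\\ \overline{c_{nN+i,\,i-l}},& i>l,\end{cases}$$ so that $E_n$ is Hermitian and $D_n$ is lower triangular and invertible; the leading coefficient of $P_n$ is lower triangular and nonsingular; and $(P_n)$ is orthonormal with respect to some positive definite matrix of measures. (2) A sequence $(P_n)$ of $N\times N$ matrix polynomials is orthonormal with respect to some positive definite matrix of measures if and only if it satisfies a matrix three-term recurrence. (3) Let $(Q_n)$ be orthonormal with respect to a positive definite matrix of measures $\mathbf M$ and satisfy the matrix three-term recurrence with coefficients $(A_n)$, $(B_n)$. Then there are unitary matrices $U_n$ such that $P_n=U_nQ_n$ is orthonormal with respect to $\mathbf M$ with lower triangular leading coefficients, and $(P_n)$ satisfies the matrix three-term recurrence with coefficients $D_n=U_{n-1}A_nU_n^*$, which are lower triangular, and $E_n=U_nB_nU_n^*$. (4) Conversely, let $(P_n)$, $P_n=(P_{n,m,j})_{m,j=0}^{N-1}$, have lower triangular leading coefficients and be orthonormal with respect to a positive definite matrix of measures or, equivalently, satisfy a matrix three-term recurrence. Then the scalar polynomials $$p_{nN+m}(x)=\sum_{j=0}^{N-1}x^jP_{n,m,j}(h(x))\qquad(n\ge0,\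 0\le m\le N-1)$$ have degrees $\deg p_n=n$ and satisfy a symmetric $(2N+1)$-term recurrence. If $(D_n)$, $(E_n)$ are the coefficients of the matrix recurrence, then the $D_n$ are lower triangular and the scalar coefficients $(c_{n,k})$ can be chosen such that $D_n$ ($n\ge 1$) and $E_n$ ($n\ge0$) are given by the formulas in (1). -/

import Mathlib

open Polynomial MeasureTheory
open scoped Matrix ComplexOrder

noncomputable section

/-- The operator `R_{h,N,j}` (`N = deg h`): the unique expansion
`p = ∑_{j < N} ∑_n a_{j,n} x^j h^n` has the coefficient `a_{j,n}` equal to the `j`-th coefficient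
of the remainder modulo `h` of the `n`-fold quotient of `p` by `h`, and
`R_{h,N,j}(p) = ∑_n a_{j,n} x^n`.  See `sum_hComponent`, `hComponent_unique` and
`hComponent_X_pow`. -/
def hComponent (h : ℂ[X]) (j : ℕ) (p : ℂ[X]) : ℂ[X] :=
  ∑ n ∈ Finset.range (p.natDegree + 1), C ((((fun q => q / h)^[n] p) % h).coeff j) * X ^ n

theorem iterate_div_eq_zero (h : ℂ[X]) (hh : 0 < h.natDegree) (n : ℕ) (p : ℂ[X])
    (hp : p.natDegree < n) : (fun q => q / h)^[n] p = 0 := by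
  induction n generalizing p with
  | zero => omega
  | succ n ih =>
    rw [Function.iterate_succ_apply]
    by_cases hd : p / h = 0
    · simp only [hd]
      exact Function.iterate_fixed (by simp) n
    · apply ih
      have h1 : p ≠ 0 := by rintro rfl; simp at hd
      have h2 := Polynomial.degree_div_lt h1 (natDegree_pos_iff_degree_pos.mp hh)
      have h3 := Polynomial.natDegree_lt_natDegree hd h2
      omega

theorem hComponent_coeff (h : ℂ[X]) (hh : 0 < h.natDegree) (j n : ℕ) (p : ℂ[X]) :
    (hComponent h j p).coeff n = (((fun q => q / h)^[n] p) % h).coeff j := by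
  simp only [hComponent, finsetSum_coeff, coeff_C_mul, coeff_X_pow]
  by_cases hn : n < p.natDegree + 1
  · rw [Finset.sum_eq_single n]
    · simp
    · intro b _ hb
      simp [hb.symm]
    · intro hb
      simp at hb
      omega
  · rw [iterate_div_eq_zero h hh n p (by omega)]
    rw [Finset.sum_eq_zero]
    · simp
    · intro b hb
      have : n ≠ b := by
        simp at hb
        omega
      simp [this]

theorem hComponent_rec (h : ℂ[X]) (hh : 0 < h.natDegree) (j : ℕ) (p : ℂ[X]) :
    hComponent h j p = C ((p % h).coeff j) + X * hComponent h j (p / h) := by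
  ext n
  rw [hComponent_coeff h hh]
  cases n with
  | zero => simp
  | succ n =>
    rw [coeff_add, coeff_X_mul, hComponent_coeff h hh, Function.iterate_succ_apply]
    simp

/-- `p(x) = ∑_{j < N} x^j R_{h,N,j}(p)(h(x))`. -/
theorem sum_hComponent {N : ℕ} (h : ℂ[X]) (hh : h.natDegree = N) (hN : 0 < N) (p : ℂ[X]) :
    ∑ j : Fin N, X ^ (j : ℕ) * (hComponent h j p).comp h = p := by
  have hh' : 0 < h.natDegree := by omega
  induction p using Polynomial.degree_lt_wf.induction with
  | h p ih =>
  by_cases hp : p = 0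
  · subst hp
    simp [hComponent]
  have h1 := ih (p / h) (Polynomial.degree_div_lt hp (natDegree_pos_iff_degree_pos.mp hh'))
  have h2 : ∑ j : Fin N, X ^ (j : ℕ) * (C ((p % h).coeff j)) = p % h := by
    rw [Fin.sum_univ_eq_sum_range (fun j => X ^ j * (C ((p % h).coeff j))) N]
    conv_rhs => rw [Polynomial.as_sum_range_C_mul_X_pow' (p := p % h) (n := N)
      (hh ▸ Polynomial.natDegree_mod_lt p (by omega))]
    exact Finset.sum_congr rfl fun j _ => mul_comm _ _
  calc ∑ j : Fin N, X ^ (j : ℕ) * (hComponent h j p).comp h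
      = ∑ j : Fin N, (X ^ (j : ℕ) * (C ((p % h).coeff j)) +
          h * (X ^ (j : ℕ) * (hComponent h j (p / h)).comp h)) := by
        refine Finset.sum_congr rfl fun j _ => ?_
        rw [hComponent_rec h hh' j p]
        simp only [add_comp, mul_comp, C_comp, X_comp]
        ring
    _ = p := by
        rw [Finset.sum_add_distrib, ← Finset.mul_sum, h1, h2]
        rw [add_comm]
        exact EuclideanDomain.div_add_mod p h

/-- The expansion in powers of `h` is unique, so it defines `R_{h,N,j}`. -/
theorem hComponent_unique {N : ℕ} (h : ℂ[X]) (hh : h.natDegree = N) (hN : 0 < N)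
    (f : Fin N → ℂ[X]) (j : Fin N) :
    hComponent h j (∑ i : Fin N, X ^ (i : ℕ) * (f i).comp h) = f j := by
  have hh' : 0 < h.natDegree := by omega
  have key : ∀ d : ℕ, ∀ f : Fin N → ℂ[X], (∀ i n, d ≤ n → (f i).coeff n = 0) →
      ∀ j : Fin N, hComponent h j (∑ i : Fin N, X ^ (i : ℕ) * (f i).comp h) = f j := by
    intro d
    induction d with
    | zero =>
      intro f hf j
      have : ∀ i, f i = 0 := fun i => by ext n; simpa using hf i n (Nat.zero_le _)
      simp [this, hComponent]
    | succ d ih =>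
      intro f hf j
      set r : ℂ[X] := ∑ i : Fin N, X ^ (i : ℕ) * C ((f i).coeff 0) with hr
      set q : ℂ[X] := ∑ i : Fin N, X ^ (i : ℕ) * ((f i).divX).comp h with hq
      have hp : ∑ i : Fin N, X ^ (i : ℕ) * (f i).comp h = r + h * q := by
        rw [hr, hq, Finset.mul_sum, ← Finset.sum_add_distrib]
        refine Finset.sum_congr rfl fun i _ => ?_
        conv_lhs => rw [← Polynomial.divX_mul_X_add (f i)]
        simp only [add_comp, mul_comp, C_comp, X_comp]
        ring
      have hdeg : r.degree < h.degree := by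
        rw [Polynomial.degree_eq_natDegree (p := h) (by rintro rfl; simp at hh'), hh]
        refine (Polynomial.degree_sum_le _ _).trans_lt ?_
        refine (Finset.sup_lt_iff (WithBot.bot_lt_coe N)).2 ?_
        intro i _
        rw [mul_comm]
        refine (Polynomial.degree_C_mul_X_pow_le _ _).trans_lt ?_
        exact Nat.cast_lt.2 i.2
      have hh0 : h ≠ 0 := by rintro rfl; simp at hh'
      have hmod : (r + h * q) % h = r := by
        rw [Polynomial.add_mod, (Polynomial.mod_eq_self_iff hh0).2 hdeg,
          EuclideanDomain.mod_eq_zero.2 (dvd_mul_right h q), add_zero]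
      have hdiv : (r + h * q) / h = q := by
        have := EuclideanDomain.div_add_mod (r + h * q) h
        rw [hmod, add_comm] at this
        exact mul_left_cancel₀ hh0 (add_left_cancel this)
      have hc : r.coeff j = (f j).coeff 0 := by
        simp only [hr, finsetSum_coeff, mul_comm (X ^ _), coeff_C_mul, coeff_X_pow]
        rw [Finset.sum_eq_single j]
        · simp
        · intro b _ hb
          have : (j : ℕ) ≠ b := fun e => hb (Fin.ext e.symm)
          simp [this]
        · simp
      rw [hp, hComponent_rec h hh', hmod, hdiv, hc, hq,
        ih (fun i => (f i).divX) (fun i n hn => by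
          rw [coeff_divX]; exact hf i (n + 1) (by omega)) j]
      rw [add_comm, mul_comm]
      exact Polynomial.divX_mul_X_add (f j)
  refine key (Finset.univ.sup fun i => (f i).natDegree + 1) f (fun i n hn => ?_) j
  have := (Finset.le_sup (f := fun i => (f i).natDegree + 1) (Finset.mem_univ i)).trans hn
  exact coeff_eq_zero_of_natDegree_lt this

/-- For `h = x^N`, `R_{N,m}(p)(x) = ∑_n p^{(nN+m)}(0) / (nN+m)! x^n`. -/
theorem hComponent_X_pow (N : ℕ) (m : Fin N) (p : ℂ[X]) (n : ℕ) :
    (hComponent (X ^ N) m p).coeff n =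
      (derivative^[n * N + m] p).eval 0 / ((n * N + m).factorial : ℂ) := by
  have hN : 0 < N := m.pos
  have h1 := congrArg (fun q : ℂ[X] => q.coeff (n * N + m))
    (sum_hComponent (X ^ N) (by simp) hN p)
  have h2 : (derivative^[n * N + m] p).eval 0 = ((n * N + m).factorial : ℂ) *
      p.coeff (n * N + m) := by
    rw [← Polynomial.coeff_zero_eq_eval_zero, Polynomial.coeff_iterate_derivative]
    simp [Nat.descFactorial_self]
  rw [h2, mul_div_cancel_left₀ _ (by exact_mod_cast Nat.factorial_ne_zero _), ← h1]
  simp only [finsetSum_coeff, ← Polynomial.expand_eq_comp_X_pow]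
  rw [Finset.sum_eq_single m]
  · rw [mul_comm, Polynomial.coeff_mul_X_pow, Polynomial.coeff_expand_mul hN]
  · intro b _ hb
    rw [mul_comm, Polynomial.coeff_mul_X_pow']
    split_ifs with hle
    · rw [Polynomial.coeff_expand hN, if_neg]
      intro hd
      apply hb
      have e1 : (n * N + m) ≡ b [MOD N] := ((Nat.modEq_iff_dvd' hle).2 hd).symm
      have e2 : (m : ℕ) ≡ b [MOD N] := by
        refine Nat.ModEq.trans ?_ e1
        simp [Nat.ModEq]
      exact Fin.ext (Nat.ModEq.eq_of_lt_of_lt e2 m.2 b.2).symm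
    · rfl
  · simp

/-- `(p_n)` satisfies the symmetric `(2N+1)`-term recurrence relation
`h p_n = c_{n,0} p_n + ∑_{k=1}^N (conj c_{n,k} p_{n-k} + c_{n+k,k} p_{n+k})`, with `p_k = 0` for
`k < 0` and with `p_0, …, p_{N-1}` of degrees `0, …, N-1`. -/
structure ScalarRecurrence (N : ℕ) (h : ℂ[X]) (c : ℕ → ℕ → ℂ) (p : ℕ → ℂ[X]) : Prop where
  init : ∀ k, k < N → (p k).degree = k
  real : ∀ n, (c n 0).im = 0
  ne_zero : ∀ n, c n N ≠ 0
  rec_eq : ∀ n, h * p n = C (c n 0) * p n +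
    ∑ k ∈ Finset.Icc 1 N, (C (starRingEnd ℂ (c n k)) * (if k ≤ n then p (n - k) else 0) +
      C (c (n + k) k) * p (n + k))

/-- The matrix polynomial `P_n` with `(m, j)` entry `R_{h,N,j}(p_{nN+m})`. -/
def toMatrixPolys (N : ℕ) (h : ℂ[X]) (p : ℕ → ℂ[X]) (n : ℕ) : Matrix (Fin N) (Fin N) ℂ[X] :=
  Matrix.of fun m j => hComponent h j (p (n * N + m))

/-- `p_{nN+m}(x) = ∑_j x^j P_{n,m,j}(h(x))`; see `toScalarPolys_apply`. -/
def toScalarPolys {N : ℕ} [NeZero N] (h : ℂ[X]) (P : ℕ → Matrix (Fin N) (Fin N) ℂ[X])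
    (q : ℕ) : ℂ[X] :=
  ∑ j : Fin N, X ^ (j : ℕ) * (P (q / N) (Fin.ofNat N q) j).comp h

theorem toScalarPolys_apply {N : ℕ} [NeZero N] (h : ℂ[X])
    (P : ℕ → Matrix (Fin N) (Fin N) ℂ[X]) (n : ℕ) (m : Fin N) :
    toScalarPolys h P (n * N + m) = ∑ j : Fin N, X ^ (j : ℕ) * (P n m j).comp h := by
  have h1 : (n * N + m) / N = n := by
    rw [mul_comm, Nat.mul_add_div (NeZero.pos N), Nat.div_eq_of_lt m.2, add_zero]
  have h2 : Fin.ofNat N (n * N + m) = m := by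
    ext
    simp [Fin.ofNat, Nat.mod_eq_of_lt m.2]
  rw [toScalarPolys, h1, h2]

/-- A constant matrix seen as a matrix polynomial. -/
def constMatrix {N : ℕ} (A : Matrix (Fin N) (Fin N) ℂ) : Matrix (Fin N) (Fin N) ℂ[X] := A.map C

/-- The coefficient of `x^n` of a matrix polynomial. -/
def matCoeff {N : ℕ} (n : ℕ) (P : Matrix (Fin N) (Fin N) ℂ[X]) : Matrix (Fin N) (Fin N) ℂ :=
  P.map fun q => q.coeff n

/-- `(P_n)` satisfies `x P_n = D_{n+1} P_{n+1} + E_n P_n + D_n^* P_{n-1}` for `n ≥ 0`, where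
`P_{-1} = 0`, `P_0` is a nonsingular constant matrix, the `E_n` are Hermitian and the `D_n`
(`n ≥ 1`; `D 0` plays no role) are nonsingular. -/
structure MatrixRecurrence {N : ℕ} (P : ℕ → Matrix (Fin N) (Fin N) ℂ[X])
    (D E : ℕ → Matrix (Fin N) (Fin N) ℂ) : Prop where
  init : ∃ A : Matrix (Fin N) (Fin N) ℂ, A.det ≠ 0 ∧ P 0 = constMatrix A
  hermitian : ∀ n, (E n).IsHermitian
  det_ne_zero : ∀ n, 1 ≤ n → (D n).det ≠ 0
  rec_zero : (X : ℂ[X]) • P 0 = constMatrix (D 1) * P 1 + constMatrix (E 0) * P 0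
  rec_succ : ∀ n, (X : ℂ[X]) • P (n + 1) = constMatrix (D (n + 2)) * P (n + 2) +
    constMatrix (E (n + 1)) * P (n + 1) + constMatrix ((D (n + 1))ᴴ) * P n

/-- The block `D_n` (`n ≥ 1`) of the banded matrix of the coefficients `c`. -/
def blockD (N : ℕ) (c : ℕ → ℕ → ℂ) (n : ℕ) : Matrix (Fin N) (Fin N) ℂ :=
  Matrix.of fun i l => if i < l then 0 else c (n * N + l) (N + l - i)

/-- The block `E_n` of the banded matrix of the coefficients `c`. -/
def blockE (N : ℕ) (c : ℕ → ℕ → ℂ) (n : ℕ) : Matrix (Fin N) (Fin N) ℂ :=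
  Matrix.of fun i l =>
    if i ≤ l then c (n * N + l) (l - i) else starRingEnd ℂ (c (n * N + i) (i - l))

/-- A positive definite `N × N` matrix of measures on the real line: a matrix of complex Borel
measures with finite moments of all orders, such that the matrix of the values on each Borel set
is positive semidefinite. -/
structure PosDefMatrixMeasure (N : ℕ) where
  entry : Fin N → Fin N → ComplexMeasure ℝ
  posSemidef : ∀ B : Set ℝ, MeasurableSet B →
    (Matrix.of fun k l => entry k l B : Matrix (Fin N) (Fin N) ℂ).PosSemidef
  moments : ∀ k l (n : ℕ), (entry k l).Integrable fun x : ℝ => (x : ℂ) ^ n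

/-- `∫ P(x) dM(x) Q(x)^*`, the `(i, j)` entry being
`∑_{k,l} ∫ P_{i,k}(x) conj (Q_{j,l}(x)) dM_{k,l}(x)`. -/
def PosDefMatrixMeasure.inner {N : ℕ} (M : PosDefMatrixMeasure N)
    (P Q : Matrix (Fin N) (Fin N) ℂ[X]) : Matrix (Fin N) (Fin N) ℂ :=
  Matrix.of fun i j => ∑ k, ∑ l, (M.entry k l).integral
    (fun x : ℝ => (P i k).eval (x : ℂ) * starRingEnd ℂ ((Q j l).eval (x : ℂ)))
    (ContinuousLinearMap.mul ℝ ℂ)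

/-- `(P_n)`, with `P_n` of degree at most `n`, is orthonormal with respect to `M`:
`∫ P_n dM P_m^* = δ_{n,m} I`.  (The leading coefficients are then nonsingular.) -/
structure IsOrthonormal {N : ℕ} (M : PosDefMatrixMeasure N)
    (P : ℕ → Matrix (Fin N) (Fin N) ℂ[X]) : Prop where
  natDegree_le : ∀ n i j, (P n i j).natDegree ≤ n
  orthonormal : ∀ n m, M.inner (P n) (P m) = if n = m then 1 else 0

end

/-!
The correspondence between scalar banded recurrences and matrix three-term recurrences is linear
algebra. The map `f ↦ ∑_j x^j f_j(h(x))` (`powerSum`) is injective and turns multiplication by `x`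
into multiplication by `h`; it sends the rows of `P_n` to `p_{nN}, …, p_{nN+N-1}`. Cutting the
banded scalar recurrence into blocks of length `N` (`band_sum_eq_block_sum`) therefore gives the
matrix recurrence with the coefficients `blockD`, `blockE`, and conversely (`X_smul_eq_iff_band`).
Comparison of leading coefficients gives `L_n = D_{n+1} L_{n+1}` for the leading coefficient `L_n`
of `P_n`; hence all `L_n` are nonsingular, and all are lower triangular if and only if `L_0` and
all `D_n` are. Unitary factors with this property come from a `QL` decomposition of `L_n`.

If `(P_n)` is orthonormal, then the `L_n` are nonsingular, so `x P_n` has a Fourier expansion in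
`P_0, …, P_{n+1}`, and symmetry of multiplication by `x` cuts it down to three terms
(`IsOrthonormal.matrixRecurrence`).

The converse is Favard's theorem for matrix polynomials. The eigenvectors of the Hermitian
truncated block Jacobi matrix have the blocks `P_i(x_t) u_t`, `i ≤ n`, with `x_t` the eigenvalue;
an orthonormal eigenbasis thus says that `P_0, …, P_n` are orthonormal with respect to the discrete
matrix of measures `∑_t u_t u_t^* δ_{x_t}` (`MatrixRecurrence.exists_quadrature`). To take a limit
as `n → ∞`, these matrices of measures are encoded as scalar measures on the space of pairs
`(x, v)`, `x` real and `v` a vector of norm one, a matrix of measures being recovered as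
`B ↦ ∫_{x ∈ B} v v^* dμ` (`PosDefMatrixMeasure.ofMeasure`); this makes positivity automatic. The
functions `(x, v) ↦ (Q(x) v)_a` with `Q` a matrix polynomial are bounded in `L²` uniformly in `n`,
since `Q` is a combination of the `P_i`. So the measures are tight, Prokhorov's theorem gives a weak
limit, and the orthonormality relations pass to it
(`exists_weak_limit`, `MatrixRecurrence.exists_isOrthonormal`).
-/

/-! ### Integration against complex measures -/

namespace MeasureTheory.ComplexMeasure

variable {α : Type*} [MeasurableSpace α]

theorem integral_indicator_const (μ : ComplexMeasure α) (c : ℂ) {s : Set α}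
    (hs : MeasurableSet s) (hμ : μ.variation s < ⊤) :
    μ.integral (s.indicator fun _ => c) (ContinuousLinearMap.mul ℝ ℂ) = c * μ s := by
  rw [VectorMeasure.integral_eq_setToFun, setToFun_indicator_const _ hs hμ.ne]
  rfl

/-- A functional on integrable functions that is additive, contractive for the `L¹` norm of the
variation and has the right values on indicators is the integral. -/
theorem integral_eq_of_contractive (μ : ComplexMeasure α) (Φ : (α → ℂ) → ℂ)
    (h_ind : ∀ (c : ℂ) (s : Set α), MeasurableSet s → μ.variation s < ⊤ →
      Φ (s.indicator fun _ => c) = c * μ s)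
    (h_add : ∀ f g, μ.Integrable f → μ.Integrable g → Φ (f + g) = Φ f + Φ g)
    (h_le : ∀ f g, μ.Integrable f → μ.Integrable g →
      ‖Φ f - Φ g‖ ≤ ∫ x, ‖f x - g x‖ ∂μ.variation)
    {f : α → ℂ} (hf : μ.Integrable f) :
    μ.integral f (ContinuousLinearMap.mul ℝ ℂ) = Φ f := by
  have hae : ∀ f g, f =ᵐ[μ.variation] g → μ.Integrable f → Φ f = Φ g := by
    intro f g hfg hf
    have h1 := h_le f g hf (hf.congr hfg)
    rw [integral_eq_zero_of_ae (by filter_upwards [hfg] with x hx; simp [hx])] at h1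
    simpa [sub_eq_zero] using h1
  refine Integrable.induction (μ := μ.variation)
    (fun f => μ.integral f (ContinuousLinearMap.mul ℝ ℂ) = Φ f) ?_ ?_ ?_ ?_ hf
  · intro c s hs hμ
    rw [integral_indicator_const μ c hs hμ, h_ind c s hs hμ]
  · intro f g _ hf hg hf' hg'
    rw [VectorMeasure.integral_add hf hg, h_add f g hf hg, hf', hg']
  · refine isClosed_eq VectorMeasure.continuous_integral ?_
    refine (LipschitzWith.of_dist_le_mul (K := 1) fun f g => ?_).continuous
    rw [dist_eq_norm, dist_eq_norm, L1.norm_eq_integral_norm]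
    refine (h_le f g (L1.integrable_coeFn f) (L1.integrable_coeFn g)).trans_eq ?_
    rw [NNReal.coe_one, one_mul]
    refine integral_congr_ae ?_
    filter_upwards [Lp.coeFn_sub f g] with x hx
    rw [hx, Pi.sub_apply]
  · intro f g hfg hf h
    rw [← VectorMeasure.integral_congr_ae hfg, h, hae f g hfg hf]

theorem integral_const_mul (μ : ComplexMeasure α) (c : ℂ) (f : α → ℂ) :
    μ.integral (fun x => c * f x) (ContinuousLinearMap.mul ℝ ℂ) =
      c * μ.integral f (ContinuousLinearMap.mul ℝ ℂ) := by
  have := setToFun_smul (μ := μ.variation) (T := μ.transpose (ContinuousLinearMap.mul ℝ ℂ))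
    (dominatedFinMeasAdditive_cbmApplyMeasure μ (ContinuousLinearMap.mul ℝ ℂ))
    (fun (c : ℂ) s x => by
      change (c * x) * μ s = c * (x * μ s)
      ring) c f
  exact this

theorem norm_integral_sub_le (μ : ComplexMeasure α) {f g : α → ℂ} (hf : μ.Integrable f)
    (hg : μ.Integrable g) :
    ‖μ.integral f (ContinuousLinearMap.mul ℝ ℂ) - μ.integral g (ContinuousLinearMap.mul ℝ ℂ)‖ ≤
      ∫ x, ‖f x - g x‖ ∂μ.variation := by
  rw [← VectorMeasure.integral_sub hf hg]
  refine (VectorMeasure.norm_integral_le_integral_norm).trans ?_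
  simp

/-- Integration against the conjugate measure is conjugate to integration. -/
theorem integral_conj {μ ν : ComplexMeasure α}
    (h : ∀ s, MeasurableSet s → ν s = starRingEnd ℂ (μ s)) {f : α → ℂ} (hf : μ.Integrable f) :
    ν.integral (fun x => starRingEnd ℂ (f x)) (ContinuousLinearMap.mul ℝ ℂ) =
      starRingEnd ℂ (μ.integral f (ContinuousLinearMap.mul ℝ ℂ)) := by
  have hvar : ν.variation = μ.variation := by
    refine le_antisymm (VectorMeasure.variation_le_of_forall_enorm_le fun s hs => ?_)
      (VectorMeasure.variation_le_of_forall_enorm_le fun s hs => ?_)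
    · rw [h s hs, enorm_eq_nnnorm, RCLike.nnnorm_conj, ← enorm_eq_nnnorm]
      exact VectorMeasure.enorm_measure_le_variation _ _
    · rw [enorm_eq_nnnorm, ← RCLike.nnnorm_conj, ← enorm_eq_nnnorm, ← h s hs]
      exact VectorMeasure.enorm_measure_le_variation _ _
  have hconj : ∀ {f : α → ℂ}, μ.Integrable f → ν.Integrable fun x => starRingEnd ℂ (f x) := by
    intro f hf
    rw [VectorMeasure.Integrable, hvar]
    exact (LinearIsometryEquiv.integrable_comp_iff (RCLike.conjLIE (K := ℂ))).2 hf
  have key := integral_eq_of_contractive μ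
    (fun f => starRingEnd ℂ
      (ν.integral (fun x => starRingEnd ℂ (f x)) (ContinuousLinearMap.mul ℝ ℂ))) ?_ ?_ ?_ hf
  · rw [key]; simp
  · intro c s hs hμ
    have : (fun x => starRingEnd ℂ (s.indicator (fun _ => c) x)) =
        s.indicator fun _ => starRingEnd ℂ c := by
      ext x
      by_cases hx : x ∈ s <;> simp [hx]
    rw [this, integral_indicator_const ν _ hs (by rwa [hvar]), h s hs]
    simp
  · intro f g hf hg
    simp only [Pi.add_apply, map_add]
    rw [VectorMeasure.integral_fun_add (hconj hf) (hconj hg), map_add]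
  · intro f g hf hg
    rw [← map_sub, RCLike.norm_conj]
    refine (norm_integral_sub_le ν (hconj hf) (hconj hg)).trans_eq ?_
    rw [hvar]
    simp only [← map_sub, RCLike.norm_conj]

theorem integrable_withDensityᵥ_iff {μ : Measure α} {g f : α → ℂ} (hg : Integrable g μ)
    (hgm : Measurable g) :
    (μ.withDensityᵥ g).Integrable f ↔ Integrable (fun x => f x * g x) μ := by
  rw [VectorMeasure.Integrable, Measure.variation_withDensityᵥ hg]
  have h2 := integrable_withDensity_iff_integrable_smul (E := ℂ) (μ := μ) (f := fun x => ‖g x‖₊)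
    (hgm.nnnorm) (g := f)
  simp only [← enorm_eq_nnnorm] at h2
  rw [h2]
  have aux : ∀ x, ‖g x‖₊ • f x = f x * g x * (‖g x‖ / g x) ∧
      f x * g x = ‖g x‖₊ • f x * (g x / ‖g x‖) := by
    intro x
    rcases eq_or_ne (g x) 0 with hx | hx
    · simp [hx]
    · have : (‖g x‖ : ℂ) ≠ 0 := by simpa using hx
      simp only [NNReal.smul_def, coe_nnnorm, Complex.real_smul]
      constructor <;> field_simp
  have hnorm : ∀ x, ‖‖g x‖₊ • f x‖ = ‖f x * g x‖ := by
    intro x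
    simp [NNReal.smul_def, mul_comm]
  constructor
  · intro h
    refine h.mono ?_ (ae_of_all _ fun x => (hnorm x).ge)
    simp only [fun x => (aux x).2]
    exact h.aestronglyMeasurable.mul
      (by fun_prop : Measurable fun x => g x / (‖g x‖ : ℂ)).aestronglyMeasurable
  · intro h
    refine h.mono ?_ (ae_of_all _ fun x => (hnorm x).le)
    simp only [fun x => (aux x).1]
    exact h.aestronglyMeasurable.mul
      (by fun_prop : Measurable fun x => (‖g x‖ : ℂ) / g x).aestronglyMeasurable

theorem integral_withDensityᵥ {μ : Measure α} {g f : α → ℂ} (hg : Integrable g μ)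
    (hgm : Measurable g) (hf : (μ.withDensityᵥ g).Integrable f) :
    (μ.withDensityᵥ g).integral f (ContinuousLinearMap.mul ℝ ℂ) = ∫ x, f x * g x ∂μ := by
  refine integral_eq_of_contractive _ (fun f => ∫ x, f x * g x ∂μ) ?_ ?_ ?_ hf
  · intro c s hs _
    rw [withDensityᵥ_apply hg hs, ← MeasureTheory.integral_const_mul, ← integral_indicator hs]
    congr with x
    by_cases hx : x ∈ s <;> simp [hx]
  · intro f₁ f₂ h₁ h₂
    rw [integrable_withDensityᵥ_iff hg hgm] at h₁ h₂
    simp only [Pi.add_apply, add_mul]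
    exact integral_add h₁ h₂
  · intro f₁ f₂ h₁ h₂
    rw [integrable_withDensityᵥ_iff hg hgm] at h₁ h₂
    rw [← integral_sub h₁ h₂, Measure.variation_withDensityᵥ hg]
    simp only [enorm_eq_nnnorm]
    rw [integral_withDensity_eq_integral_smul hgm.nnnorm]
    refine (norm_integral_le_integral_norm _).trans_eq ?_
    refine integral_congr_ae (ae_of_all _ fun x => ?_)
    simp only [← sub_mul, norm_mul, NNReal.smul_def, coe_nnnorm, smul_eq_mul]
    ring

end MeasureTheory.ComplexMeasure

/-! ### The matrix inner product of matrix polynomials -/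

section Inner

variable {N : ℕ}

theorem constMatrix_mul_apply (A : Matrix (Fin N) (Fin N) ℂ) (P : Matrix (Fin N) (Fin N) ℂ[X])
    (i j : Fin N) : (constMatrix A * P) i j = ∑ k, C (A i k) * P k j := by
  simp [Matrix.mul_apply, constMatrix]

theorem constMatrix_mul (A B : Matrix (Fin N) (Fin N) ℂ) :
    constMatrix (A * B) = constMatrix A * constMatrix B :=
  Matrix.map_mul

theorem constMatrix_zero : constMatrix (0 : Matrix (Fin N) (Fin N) ℂ) = 0 :=
  Matrix.map_zero C C_0

namespace PosDefMatrixMeasure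

variable (M : PosDefMatrixMeasure N)

theorem integrable_eval (k l : Fin N) (q : ℂ[X]) :
    (M.entry k l).Integrable fun x : ℝ => q.eval (x : ℂ) := by
  simp only [eval_eq_sum_range]
  exact integrable_finsetSum _ fun n _ => (M.moments k l n).const_mul _

/-- Integration of polynomials against the `(k, l)` entry of the matrix of measures. -/
noncomputable def moment (k l : Fin N) : ℂ[X] →ₗ[ℂ] ℂ where
  toFun q := (M.entry k l).integral (fun x : ℝ => q.eval (x : ℂ)) (ContinuousLinearMap.mul ℝ ℂ)
  map_add' p q := by
    simp only [eval_add]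
    exact VectorMeasure.integral_fun_add (M.integrable_eval k l p) (M.integrable_eval k l q)
  map_smul' c p := by
    simp only [eval_smul, smul_eq_mul, RingHom.id_apply]
    exact ComplexMeasure.integral_const_mul _ _ _

theorem eval_map_conj (q : ℂ[X]) (x : ℝ) :
    (q.map (starRingEnd ℂ)).eval (x : ℂ) = starRingEnd ℂ (q.eval (x : ℂ)) := by
  conv_lhs => rw [← Complex.conj_ofReal x]
  exact eval_map_apply (starRingEnd ℂ) (x : ℂ)

theorem moment_conj (k l : Fin N) (q : ℂ[X]) :
    M.moment l k (q.map (starRingEnd ℂ)) = starRingEnd ℂ (M.moment k l q) := by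
  simp only [moment, LinearMap.coe_mk, AddHom.coe_mk, eval_map_conj]
  refine ComplexMeasure.integral_conj (fun s hs => ?_) (M.integrable_eval k l q)
  exact ((M.posSemidef s hs).isHermitian.apply l k).symm

theorem inner_apply (P Q : Matrix (Fin N) (Fin N) ℂ[X]) (i j : Fin N) :
    M.inner P Q i j = ∑ k, ∑ l, M.moment k l (P i k * (Q j l).map (starRingEnd ℂ)) := by
  simp [inner, moment, eval_map_conj]

theorem inner_add_left (P P' Q : Matrix (Fin N) (Fin N) ℂ[X]) :
    M.inner (P + P') Q = M.inner P Q + M.inner P' Q := by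
  ext i j
  simp only [inner_apply, Matrix.add_apply, add_mul, map_add, Finset.sum_add_distrib]

theorem inner_constMatrix_mul_left (A : Matrix (Fin N) (Fin N) ℂ)
    (P Q : Matrix (Fin N) (Fin N) ℂ[X]) :
    M.inner (constMatrix A * P) Q = A * M.inner P Q := by
  ext i j
  rw [Matrix.mul_apply, inner_apply]
  simp only [inner_apply, constMatrix_mul_apply, Finset.sum_mul, Finset.mul_sum, map_sum]
  simp only [← smul_eq_C_mul, smul_mul_assoc, map_smul, smul_eq_mul]
  simp only [Finset.sum_comm (s := Finset.univ (α := Fin N)) (t := Finset.univ (α := Fin N))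
    (f := fun l a => A i a * _)]
  rw [Finset.sum_comm]

theorem conjTranspose_inner (P Q : Matrix (Fin N) (Fin N) ℂ[X]) :
    (M.inner P Q)ᴴ = M.inner Q P := by
  ext i j
  rw [Matrix.conjTranspose_apply, inner_apply, inner_apply, Finset.sum_comm]
  simp only [star_sum, RCLike.star_def]
  refine Finset.sum_congr rfl fun l _ => Finset.sum_congr rfl fun k _ => ?_
  rw [← moment_conj, Polynomial.map_mul, Polynomial.map_map, mul_comm]
  simp

theorem inner_constMatrix_mul_right (A : Matrix (Fin N) (Fin N) ℂ)
    (P Q : Matrix (Fin N) (Fin N) ℂ[X]) :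
    M.inner P (constMatrix A * Q) = M.inner P Q * Aᴴ := by
  rw [← conjTranspose_inner, inner_constMatrix_mul_left, Matrix.conjTranspose_mul,
    conjTranspose_inner]

theorem inner_X_smul (P Q : Matrix (Fin N) (Fin N) ℂ[X]) :
    M.inner ((X : ℂ[X]) • P) Q = M.inner P ((X : ℂ[X]) • Q) := by
  ext i j
  simp only [inner_apply, Matrix.smul_apply, smul_eq_mul, Polynomial.map_mul, map_X]
  refine Finset.sum_congr rfl fun l _ => Finset.sum_congr rfl fun k _ => ?_
  congr 1
  ring

/-- The inner product as an additive function of its first argument. -/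
noncomputable def innerLeft (Q : Matrix (Fin N) (Fin N) ℂ[X]) :
    Matrix (Fin N) (Fin N) ℂ[X] →+ Matrix (Fin N) (Fin N) ℂ :=
  AddMonoidHom.mk' (fun P => M.inner P Q) fun P P' => M.inner_add_left P P' Q

theorem inner_sum_left {ι : Type*} (s : Finset ι) (c : ι → Matrix (Fin N) (Fin N) ℂ)
    (P : ι → Matrix (Fin N) (Fin N) ℂ[X]) (Q : Matrix (Fin N) (Fin N) ℂ[X]) :
    M.inner (∑ i ∈ s, constMatrix (c i) * P i) Q = ∑ i ∈ s, c i * M.inner (P i) Q :=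
  (map_sum (M.innerLeft Q) _ s).trans
    (Finset.sum_congr rfl fun i _ => M.inner_constMatrix_mul_left (c i) (P i) Q)

end PosDefMatrixMeasure

/-! ### Expansions in matrix polynomials with nonsingular leading coefficients -/

theorem matCoeff_add (n : ℕ) (P Q : Matrix (Fin N) (Fin N) ℂ[X]) :
    matCoeff n (P + Q) = matCoeff n P + matCoeff n Q := by
  ext i j; simp [matCoeff]

theorem matCoeff_sum {ι : Type*} (n : ℕ) (s : Finset ι)
    (P : ι → Matrix (Fin N) (Fin N) ℂ[X]) :
    matCoeff n (∑ i ∈ s, P i) = ∑ i ∈ s, matCoeff n (P i) := by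
  ext i j; simp [matCoeff, Matrix.sum_apply, finsetSum_coeff]

theorem matCoeff_sub (n : ℕ) (P Q : Matrix (Fin N) (Fin N) ℂ[X]) :
    matCoeff n (P - Q) = matCoeff n P - matCoeff n Q := by
  ext i j; simp [matCoeff]

theorem matCoeff_constMatrix_mul (n : ℕ) (A : Matrix (Fin N) (Fin N) ℂ)
    (P : Matrix (Fin N) (Fin N) ℂ[X]) :
    matCoeff n (constMatrix A * P) = A * matCoeff n P := by
  ext i j
  simp [matCoeff, constMatrix, Matrix.mul_apply, finsetSum_coeff]

theorem matCoeff_succ_X_smul (n : ℕ) (P : Matrix (Fin N) (Fin N) ℂ[X]) :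
    matCoeff (n + 1) ((X : ℂ[X]) • P) = matCoeff n P := by
  ext i j; simp [matCoeff]

theorem ext_matCoeff {P Q : Matrix (Fin N) (Fin N) ℂ[X]}
    (h : ∀ n, matCoeff n P = matCoeff n Q) : P = Q := by
  ext i j n
  exact congrFun (congrFun (h n) i) j

theorem natDegree_le_iff_matCoeff {P : Matrix (Fin N) (Fin N) ℂ[X]} {n : ℕ} :
    (∀ i j, (P i j).natDegree ≤ n) ↔ ∀ k, n < k → matCoeff k P = 0 := by
  constructor
  · intro h k hk
    ext i j
    exact coeff_eq_zero_of_natDegree_lt ((h i j).trans_lt hk)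
  · intro h i j
    exact natDegree_le_iff_coeff_eq_zero.2 fun k hk => congrFun (congrFun (h k hk) i) j

/-- If `P_i` has degree `i` and a nonsingular leading coefficient for `i < n`, then every matrix
polynomial of degree less than `n` is a left combination of `P_0, …, P_{n-1}`. -/
theorem exists_eq_sum_constMatrix_mul {P : ℕ → Matrix (Fin N) (Fin N) ℂ[X]} (n : ℕ)
    (hdeg : ∀ i < n, ∀ k, i < k → matCoeff k (P i) = 0)
    (hdet : ∀ i < n, (matCoeff i (P i)).det ≠ 0)
    (Q : Matrix (Fin N) (Fin N) ℂ[X]) (hQ : ∀ k, n ≤ k → matCoeff k Q = 0) :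
    ∃ c : ℕ → Matrix (Fin N) (Fin N) ℂ,
      Q = ∑ i ∈ Finset.range n, constMatrix (c i) * P i := by
  induction n generalizing Q with
  | zero =>
    refine ⟨0, ?_⟩
    rw [Finset.sum_range_zero]
    exact ext_matCoeff fun n => by rw [hQ n (Nat.zero_le n)]; ext; simp [matCoeff]
  | succ n ih =>
    set c := matCoeff n Q * (matCoeff n (P n))⁻¹ with hc
    obtain ⟨d, hd⟩ := ih (fun i hi => hdeg i (by omega)) (fun i hi => hdet i (by omega))
      (Q - constMatrix c * P n) (fun k hk => by
        rw [matCoeff_sub, matCoeff_constMatrix_mul]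
        rcases hk.eq_or_lt with rfl | hk
        · rw [hc, Matrix.mul_assoc, Matrix.nonsing_inv_mul _ (hdet n (by omega)).isUnit,
            Matrix.mul_one, sub_self]
        · rw [hQ k hk, hdeg n (by omega) k hk, Matrix.mul_zero, sub_self])
    refine ⟨Function.update d n c, ?_⟩
    rw [Finset.sum_range_succ, Function.update_self, ← sub_eq_iff_eq_add, hd]
    refine Finset.sum_congr rfl fun i hi => ?_
    rw [Function.update_of_ne (Finset.mem_range.1 hi).ne]

end Inner

/-! ### From orthonormality to the three-term recurrence -/

namespace IsOrthonormal

variable {N : ℕ} {M : PosDefMatrixMeasure N} {P : ℕ → Matrix (Fin N) (Fin N) ℂ[X]}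

theorem matCoeff_eq_zero (hP : IsOrthonormal M P) {n k : ℕ} (h : n < k) :
    matCoeff k (P n) = 0 :=
  natDegree_le_iff_matCoeff.1 (hP.natDegree_le n) k h

/-- The leading coefficients are nonsingular: if `V` annihilated the leading coefficient of `P_n`
from the left, then `V P_n` would be a combination of `P_0, …, P_{n-1}`, hence orthogonal to
`P_n`, and `V = V ⟨P_n, P_n⟩ = 0`. -/
theorem det_matCoeff_ne_zero (hP : IsOrthonormal M P) (n : ℕ) : (matCoeff n (P n)).det ≠ 0 := by
  induction n using Nat.strong_induction_on with
  | _ n ih =>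
  intro h0
  obtain ⟨v, hv, hv0⟩ := Matrix.exists_vecMul_eq_zero_iff.2 h0
  obtain ⟨i₀, hi₀⟩ := Function.ne_iff.1 hv
  set V : Matrix (Fin N) (Fin N) ℂ := Matrix.of fun _ => v
  have hV : V * matCoeff n (P n) = 0 := by
    ext i j
    exact congrFun hv0 j
  obtain ⟨c, hc⟩ := exists_eq_sum_constMatrix_mul n (fun i _ k hk => hP.matCoeff_eq_zero hk) ih
    (constMatrix V * P n) fun k hk => by
      rw [matCoeff_constMatrix_mul]
      rcases hk.eq_or_lt with rfl | hk
      · exact hV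
      · rw [hP.matCoeff_eq_zero hk, Matrix.mul_zero]
  have h1 : M.inner (constMatrix V * P n) (P n) = V := by
    rw [M.inner_constMatrix_mul_left, hP.orthonormal, if_pos rfl, Matrix.mul_one]
  rw [hc, M.inner_sum_left, Finset.sum_eq_zero] at h1
  · exact hi₀ (congrFun (congrFun h1.symm i₀) i₀)
  · intro i hi
    rw [hP.orthonormal, if_neg (Finset.mem_range.1 hi).ne, Matrix.mul_zero]

/-- Fourier expansion of a matrix polynomial of degree less than `n`. -/
theorem eq_sum_inner (hP : IsOrthonormal M P) (n : ℕ) (Q : Matrix (Fin N) (Fin N) ℂ[X])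
    (hQ : ∀ k, n ≤ k → matCoeff k Q = 0) :
    Q = ∑ i ∈ Finset.range n, constMatrix (M.inner Q (P i)) * P i := by
  obtain ⟨c, hc⟩ := exists_eq_sum_constMatrix_mul n (fun i _ k hk => hP.matCoeff_eq_zero hk)
    (fun i _ => hP.det_matCoeff_ne_zero i) Q hQ
  conv_lhs => rw [hc]
  refine Finset.sum_congr rfl fun i hi => ?_
  rw [hc, M.inner_sum_left, Finset.sum_eq_single i]
  · rw [hP.orthonormal, if_pos rfl, Matrix.mul_one]
  · intro j _ hj
    rw [hP.orthonormal, if_neg hj, Matrix.mul_zero]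
  · exact fun h => absurd hi h

theorem inner_eq_zero (hP : IsOrthonormal M P) {n : ℕ} {Q : Matrix (Fin N) (Fin N) ℂ[X]}
    (hQ : ∀ k, n ≤ k → matCoeff k Q = 0) : M.inner Q (P n) = 0 := by
  rw [hP.eq_sum_inner n Q hQ, M.inner_sum_left, Finset.sum_eq_zero]
  intro i hi
  rw [hP.orthonormal, if_neg (Finset.mem_range.1 hi).ne, Matrix.mul_zero]

theorem matCoeff_X_smul_eq_zero (hP : IsOrthonormal M P) {n k : ℕ} (h : n + 2 ≤ k) :
    matCoeff k ((X : ℂ[X]) • P n) = 0 := by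
  obtain ⟨k, rfl⟩ : ∃ l, k = l + 1 := ⟨k - 1, by omega⟩
  rw [matCoeff_succ_X_smul, hP.matCoeff_eq_zero (by omega)]

/-- The Jacobi operator of `(P_n)` has no entries below the first block subdiagonal, because
multiplication by `x` is symmetric. -/
theorem inner_X_smul_eq_zero (hP : IsOrthonormal M P) {n i : ℕ} (h : i + 2 ≤ n) :
    M.inner ((X : ℂ[X]) • P n) (P i) = 0 := by
  rw [M.inner_X_smul, ← M.conjTranspose_inner,
    hP.inner_eq_zero fun k hk => hP.matCoeff_X_smul_eq_zero (h.trans hk),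
    Matrix.conjTranspose_zero]

theorem X_smul_zero (hP : IsOrthonormal M P) :
    (X : ℂ[X]) • P 0 = constMatrix (M.inner ((X : ℂ[X]) • P 0) (P 1)) * P 1 +
      constMatrix (M.inner ((X : ℂ[X]) • P 0) (P 0)) * P 0 := by
  conv_lhs => rw [hP.eq_sum_inner 2 _ fun k hk => hP.matCoeff_X_smul_eq_zero hk]
  rw [Finset.sum_range_succ, Finset.sum_range_one, add_comm]

theorem X_smul_succ (hP : IsOrthonormal M P) (n : ℕ) :
    (X : ℂ[X]) • P (n + 1) =
      constMatrix (M.inner ((X : ℂ[X]) • P (n + 1)) (P (n + 2))) * P (n + 2) +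
      constMatrix (M.inner ((X : ℂ[X]) • P (n + 1)) (P (n + 1))) * P (n + 1) +
      constMatrix (M.inner ((X : ℂ[X]) • P (n + 1)) (P n)) * P n := by
  conv_lhs => rw [hP.eq_sum_inner (n + 3) _ fun k hk => hP.matCoeff_X_smul_eq_zero hk]
  rw [Finset.sum_range_succ, Finset.sum_range_succ, Finset.sum_range_succ, Finset.sum_eq_zero]
  · abel
  · intro i hi
    rw [hP.inner_X_smul_eq_zero (by have := Finset.mem_range.1 hi; omega), constMatrix_zero,
      Matrix.zero_mul]

theorem matrixRecurrence (hP : IsOrthonormal M P) :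
    MatrixRecurrence P (fun n => M.inner ((X : ℂ[X]) • P (n - 1)) (P n))
      (fun n => M.inner ((X : ℂ[X]) • P n) (P n)) where
  init := by
    refine ⟨matCoeff 0 (P 0), hP.det_matCoeff_ne_zero 0, ?_⟩
    refine Matrix.ext fun i j => ?_
    exact eq_C_of_natDegree_le_zero (hP.natDegree_le 0 i j)
  hermitian n := by
    rw [Matrix.IsHermitian, M.conjTranspose_inner, M.inner_X_smul]
  det_ne_zero n hn := by
    obtain ⟨n, rfl⟩ : ∃ l, n = l + 1 := ⟨n - 1, by omega⟩
    -- comparison of the coefficients of `x^(n+1)` in the Fourier expansion of `x P_n`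
    have h1 := congrArg (matCoeff (n + 1))
      (hP.eq_sum_inner (n + 2) _ fun k hk => hP.matCoeff_X_smul_eq_zero (n := n) hk)
    rw [matCoeff_succ_X_smul, Finset.sum_range_succ, matCoeff_add] at h1
    have h2 : matCoeff (n + 1) (∑ i ∈ Finset.range (n + 1),
        constMatrix (M.inner ((X : ℂ[X]) • P n) (P i)) * P i) = 0 := by
      rw [matCoeff_sum, Finset.sum_eq_zero]
      intro i hi
      rw [matCoeff_constMatrix_mul, hP.matCoeff_eq_zero (Finset.mem_range.1 hi), Matrix.mul_zero]
    rw [h2, zero_add, matCoeff_constMatrix_mul] at h1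
    have h3 := hP.det_matCoeff_ne_zero n
    rw [h1, Matrix.det_mul] at h3
    exact left_ne_zero_of_mul h3
  rec_zero := hP.X_smul_zero
  rec_succ n := by
    rw [M.conjTranspose_inner, ← M.inner_X_smul]
    exact hP.X_smul_succ n

end IsOrthonormal

/-! ### Consequences of the three-term recurrence -/

namespace MatrixRecurrence

variable {N : ℕ} {P : ℕ → Matrix (Fin N) (Fin N) ℂ[X]} {D E : ℕ → Matrix (Fin N) (Fin N) ℂ}

theorem constMatrix_mul_succ (hP : MatrixRecurrence P D E) (n : ℕ) :
    constMatrix (D (n + 1)) * P (n + 1) = (X : ℂ[X]) • P n - constMatrix (E n) * P n -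
      if n = 0 then 0 else constMatrix (D n)ᴴ * P (n - 1) := by
  cases n with
  | zero => rw [hP.rec_zero]; simp
  | succ n =>
    rw [hP.rec_succ]
    simp only [Nat.add_eq_zero_iff, one_ne_zero, and_false, if_false, Nat.add_sub_cancel]
    abel

theorem matCoeff_eq_zero (hP : MatrixRecurrence P D E) {n k : ℕ} (h : n < k) :
    matCoeff k (P n) = 0 := by
  induction n using Nat.strong_induction_on generalizing k with
  | _ n ih =>
  cases n with
  | zero =>
    obtain ⟨A, -, hA⟩ := hP.init
    ext i j
    simp [hA, matCoeff, constMatrix, coeff_C, h.ne']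
  | succ n =>
    obtain ⟨k, rfl⟩ : ∃ l, k = l + 1 := ⟨k - 1, by omega⟩
    have h1 : D (n + 1) * matCoeff (k + 1) (P (n + 1)) = 0 := by
      rw [← matCoeff_constMatrix_mul, hP.constMatrix_mul_succ, matCoeff_sub, matCoeff_sub,
        matCoeff_constMatrix_mul, matCoeff_succ_X_smul, ih n (by omega) (by omega),
        ih n (by omega) (by omega)]
      split_ifs with h0
      · ext; simp [matCoeff]
      · rw [matCoeff_constMatrix_mul, ih (n - 1) (by omega) (by omega)]
        simp
    exact (Matrix.isUnit_iff_isUnit_det _).2 (hP.det_ne_zero (n + 1) (by omega)).isUnit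
      |>.mul_right_eq_zero.1 h1

theorem natDegree_le (hP : MatrixRecurrence P D E) (n : ℕ) (i j : Fin N) :
    (P n i j).natDegree ≤ n :=
  natDegree_le_iff_matCoeff.2 (fun _ hk => hP.matCoeff_eq_zero hk) i j

/-- Comparison of the coefficients of `x^(n+1)` in the recurrence. -/
theorem matCoeff_self (hP : MatrixRecurrence P D E) (n : ℕ) :
    matCoeff n (P n) = D (n + 1) * matCoeff (n + 1) (P (n + 1)) := by
  rw [← matCoeff_constMatrix_mul, hP.constMatrix_mul_succ, matCoeff_sub, matCoeff_sub,
    matCoeff_constMatrix_mul, matCoeff_succ_X_smul, hP.matCoeff_eq_zero (n.lt_succ_self)]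
  split_ifs with h0
  · ext; simp [matCoeff]
  · rw [matCoeff_constMatrix_mul, hP.matCoeff_eq_zero (show n - 1 < n + 1 by omega)]
    simp

theorem det_matCoeff_ne_zero (hP : MatrixRecurrence P D E) (n : ℕ) :
    (matCoeff n (P n)).det ≠ 0 := by
  induction n with
  | zero =>
    obtain ⟨A, h, hA⟩ := hP.init
    rwa [hA, show matCoeff 0 (constMatrix A) = A by ext; simp [matCoeff, constMatrix]]
  | succ n ih =>
    rw [hP.matCoeff_self, Matrix.det_mul] at ih
    exact right_ne_zero_of_mul ih

theorem _root_.Matrix.IsLowerTriangular.nonsing_inv {A : Matrix (Fin N) (Fin N) ℂ}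
    (hA : A.IsLowerTriangular) (h : A.det ≠ 0) : A⁻¹.IsLowerTriangular := by
  have := A.invertibleOfIsUnitDet h.isUnit
  exact Matrix.blockTriangular_inv_of_blockTriangular hA

theorem isLowerTriangular_of_matCoeff (hP : MatrixRecurrence P D E)
    (hL : ∀ n, (matCoeff n (P n)).IsLowerTriangular) {n : ℕ} (hn : 1 ≤ n) :
    (D n).IsLowerTriangular := by
  obtain ⟨n, rfl⟩ : ∃ l, n = l + 1 := ⟨n - 1, by omega⟩
  have h1 : D (n + 1) = matCoeff n (P n) * (matCoeff (n + 1) (P (n + 1)))⁻¹ := by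
    rw [hP.matCoeff_self, Matrix.mul_assoc,
      Matrix.mul_nonsing_inv _ (hP.det_matCoeff_ne_zero _).isUnit, Matrix.mul_one]
  rw [h1]
  exact (hL n).mul ((hL (n + 1)).nonsing_inv (hP.det_matCoeff_ne_zero _))

theorem matCoeff_isLowerTriangular (hP : MatrixRecurrence P D E)
    (h0 : (matCoeff 0 (P 0)).IsLowerTriangular) (hD : ∀ n, 1 ≤ n → (D n).IsLowerTriangular)
    (n : ℕ) : (matCoeff n (P n)).IsLowerTriangular := by
  induction n with
  | zero => exact h0
  | succ n ih =>
    have hd := hP.det_ne_zero (n + 1) (by omega)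
    have h1 : matCoeff (n + 1) (P (n + 1)) = (D (n + 1))⁻¹ * matCoeff n (P n) := by
      rw [hP.matCoeff_self n, ← Matrix.mul_assoc, Matrix.nonsing_inv_mul _ hd.isUnit,
        Matrix.one_mul]
    rw [h1]
    exact ((hD (n + 1) (by omega)).nonsing_inv hd).mul ih

/-- Multiplication of the `P_n` from the left by unitary matrices. -/
theorem unitary_mul (hP : MatrixRecurrence P D E) {U : ℕ → Matrix (Fin N) (Fin N) ℂ}
    (hU : ∀ n, U n ∈ Matrix.unitaryGroup (Fin N) ℂ) :
    MatrixRecurrence (fun n => constMatrix (U n) * P n)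
      (fun n => U (n - 1) * D n * (U n)ᴴ) (fun n => U n * E n * (U n)ᴴ) := by
  have hUU : ∀ n, (U n)ᴴ * U n = 1 := fun n => Matrix.mem_unitaryGroup_iff'.1 (hU n)
  have hdet : ∀ n, (U n).det ≠ 0 := fun n h => by
    have := congrArg Matrix.det (hUU n)
    rw [Matrix.det_mul, h, mul_zero, Matrix.det_one] at this
    exact zero_ne_one this
  have hdet' : ∀ n, (U n)ᴴ.det ≠ 0 := fun n => by
    rw [Matrix.det_conjTranspose]
    exact star_ne_zero.2 (hdet n)
  have hX : ∀ n, (X : ℂ[X]) • (constMatrix (U n) * P n) =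
      constMatrix (U n) * ((X : ℂ[X]) • P n) := fun n => (Matrix.mul_smul _ _ _).symm
  have hc : ∀ (A : Matrix (Fin N) (Fin N) ℂ) (n : ℕ),
      constMatrix (A * (U n)ᴴ) * (constMatrix (U n) * P n) = constMatrix A * P n := by
    intro A n
    rw [← Matrix.mul_assoc, ← constMatrix_mul, Matrix.mul_assoc, hUU, Matrix.mul_one]
  refine ⟨?_, fun n => ?_, fun n hn => ?_, ?_, fun n => ?_⟩
  · obtain ⟨A, h, hA⟩ := hP.init
    refine ⟨U 0 * A, ?_, ?_⟩
    · rw [Matrix.det_mul]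
      exact mul_ne_zero (hdet 0) h
    · simp only [hA, constMatrix_mul]
  · exact Matrix.isHermitian_mul_mul_conjTranspose _ (hP.hermitian n)
  · rw [Matrix.det_mul, Matrix.det_mul]
    exact mul_ne_zero (mul_ne_zero (hdet _) (hP.det_ne_zero n hn)) (hdet' n)
  · simp only [hX, hc, hP.rec_zero, Matrix.mul_add]
    simp only [constMatrix_mul, Matrix.mul_assoc]
  · have h1 : (U (n + 1 - 1) * D (n + 1) * (U (n + 1))ᴴ)ᴴ =
        U (n + 1) * (D (n + 1))ᴴ * (U n)ᴴ := by
      rw [Matrix.conjTranspose_mul, Matrix.conjTranspose_mul, Matrix.conjTranspose_conjTranspose,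
        Matrix.mul_assoc, Nat.add_sub_cancel]
    simp only [h1, hX, hc, hP.rec_succ, Matrix.mul_add]
    simp only [constMatrix_mul, Matrix.mul_assoc]
    rfl

end MatrixRecurrence

/-- The `QL` decomposition: Gram–Schmidt orthonormalization of the columns of a matrix, starting
with the last one. -/
theorem exists_unitary_mul_isLowerTriangular {N : ℕ} (L : Matrix (Fin N) (Fin N) ℂ) :
    ∃ U ∈ Matrix.unitaryGroup (Fin N) ℂ, (U * L).IsLowerTriangular := by
  let f : (Fin N)ᵒᵈ → EuclideanSpace ℂ (Fin N) := fun i => WithLp.toLp 2 fun k => L k i.ofDual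
  have hcard : Module.finrank ℂ (EuclideanSpace ℂ (Fin N)) = Fintype.card (Fin N)ᵒᵈ := by simp
  let b := InnerProductSpace.gramSchmidtOrthonormalBasis hcard f
  refine ⟨Matrix.of fun i k => star (b (OrderDual.toDual i) k), ?_, ?_⟩
  · rw [Matrix.mem_unitaryGroup_iff]
    ext i j
    have := (orthonormal_iff_ite.1 b.orthonormal) (OrderDual.toDual i) (OrderDual.toDual j)
    rw [PiLp.inner_apply] at this
    simp only [Matrix.mul_apply, Matrix.star_apply, Matrix.of_apply, star_star, Matrix.one_apply]
    simpa [mul_comm] using this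
  · intro i j hij
    have hij' : OrderDual.toDual j < OrderDual.toDual i := hij
    have := InnerProductSpace.gramSchmidtOrthonormalBasis_inv_triangular hcard f hij'
    rw [PiLp.inner_apply] at this
    simpa [Matrix.mul_apply, f, b, mul_comm] using this

theorem IsOrthonormal.unitary_mul {N : ℕ} {M : PosDefMatrixMeasure N}
    {P : ℕ → Matrix (Fin N) (Fin N) ℂ[X]} (hP : IsOrthonormal M P)
    {U : ℕ → Matrix (Fin N) (Fin N) ℂ} (hU : ∀ n, U n ∈ Matrix.unitaryGroup (Fin N) ℂ) :
    IsOrthonormal M fun n => constMatrix (U n) * P n := by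
  constructor
  · intro n
    rw [natDegree_le_iff_matCoeff]
    intro k hk
    rw [matCoeff_constMatrix_mul, hP.matCoeff_eq_zero hk, Matrix.mul_zero]
  · intro n m
    rw [M.inner_constMatrix_mul_left, M.inner_constMatrix_mul_right, hP.orthonormal]
    split_ifs with h
    · subst h
      rw [Matrix.one_mul]
      exact Matrix.mem_unitaryGroup_iff.1 (hU n)
    · simp

/-! ### The banded scalar recurrence in block form -/

/-- The indices `m + 1, …, m + N` are those above `m` in the block `0, …, N - 1` and those up to
`m` in the next block. -/
theorem sum_Icc_add_eq {R : Type*} [AddCommMonoid R] {N : ℕ} (m : Fin N) (g : ℕ → R) :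
    ∑ k ∈ Finset.Icc 1 N, g (m + k) =
      (∑ l : Fin N, if m < l then g l else 0) + ∑ l : Fin N, if l ≤ m then g (N + l) else 0 := by
  have hm := m.2
  simp only [Fin.lt_def, Fin.le_def]
  rw [Fin.sum_univ_eq_sum_range (fun l => if (m : ℕ) < l then g l else 0),
    Fin.sum_univ_eq_sum_range (fun l => if l ≤ (m : ℕ) then g (N + l) else 0),
    ← Finset.sum_filter, ← Finset.sum_filter,
    ← Finset.sum_filter_add_sum_filter_not _ fun k => (m : ℕ) + k < N]
  congr 1
  · refine Finset.sum_nbij' (fun k => m + k) (fun l => l - m) ?_ ?_ ?_ ?_ ?_ <;>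
      simp only [Finset.mem_filter, Finset.mem_Icc, Finset.mem_range] <;> intros <;>
      first | omega | trivial
  · refine Finset.sum_nbij' (fun k => m + k - N) (fun l => N + l - m) ?_ ?_ ?_ ?_ ?_ <;>
      simp only [Finset.mem_filter, Finset.mem_Icc, Finset.mem_range] <;> intros <;>
      first | omega | (congr 1; omega)

/-- The indices `m - 1, …, m - N`, shifted by `N`: those from `m` on in one block and those below
`m` in the next block. -/
theorem sum_Icc_sub_eq {R : Type*} [AddCommMonoid R] {N : ℕ} (m : Fin N) (g : ℕ → R) :
    ∑ k ∈ Finset.Icc 1 N, g (N + m - k) =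
      (∑ l : Fin N, if m ≤ l then g l else 0) + ∑ l : Fin N, if l < m then g (N + l) else 0 := by
  have hm := m.2
  simp only [Fin.lt_def, Fin.le_def]
  rw [Fin.sum_univ_eq_sum_range (fun l => if (m : ℕ) ≤ l then g l else 0),
    Fin.sum_univ_eq_sum_range (fun l => if l < (m : ℕ) then g (N + l) else 0),
    ← Finset.sum_filter, ← Finset.sum_filter,
    ← Finset.sum_filter_add_sum_filter_not _ fun k => (m : ℕ) < k]
  congr 1
  · refine Finset.sum_nbij' (fun k => N + m - k) (fun l => N + m - l) ?_ ?_ ?_ ?_ ?_ <;>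
      simp only [Finset.mem_filter, Finset.mem_Icc, Finset.mem_range] <;> intros <;>
      first | omega | trivial
  · refine Finset.sum_nbij' (fun k => m - k) (fun l => m - l) ?_ ?_ ?_ ?_ ?_ <;>
      simp only [Finset.mem_filter, Finset.mem_Icc, Finset.mem_range] <;> intros <;>
      first | omega | (congr 1; omega)

/-- The right-hand side of the scalar recurrence at the index `nN + m`, arranged in blocks of
length `N`. -/
theorem band_sum_eq_block_sum {N : ℕ} (c : ℕ → ℕ → ℂ) (p : ℕ → ℂ[X]) (n : ℕ) (m : Fin N) :
    C (c (n * N + m) 0) * p (n * N + m) +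
      ∑ k ∈ Finset.Icc 1 N, (C (starRingEnd ℂ (c (n * N + m) k)) *
        (if k ≤ n * N + m then p (n * N + m - k) else 0) +
        C (c (n * N + m + k) k) * p (n * N + m + k)) =
    ∑ l : Fin N, C (blockD N c (n + 1) m l) * p ((n + 1) * N + l) +
      ∑ l : Fin N, C (blockE N c n m l) * p (n * N + l) +
      if n = 0 then 0 else ∑ l : Fin N, C ((blockD N c n)ᴴ m l) * p ((n - 1) * N + l) := by
  rw [Finset.sum_add_distrib]
  have hup := sum_Icc_add_eq m fun j => C (c (n * N + j) (j - m)) * p (n * N + j)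
  have hdown := sum_Icc_sub_eq m fun j => C (starRingEnd ℂ (c (n * N + m) (N + m - j))) *
    (if N ≤ n * N + j then p (n * N + j - N) else 0)
  have e1 : ∑ k ∈ Finset.Icc 1 N, C (c (n * N + m + k) k) * p (n * N + m + k) =
      ∑ k ∈ Finset.Icc 1 N, C (c (n * N + (m + k)) (m + k - m)) * p (n * N + (m + k)) :=
    Finset.sum_congr rfl fun k _ => by rw [Nat.add_sub_cancel_left, add_assoc]
  have e2 : ∑ k ∈ Finset.Icc 1 N, C (starRingEnd ℂ (c (n * N + m) k)) *
        (if k ≤ n * N + m then p (n * N + m - k) else 0) =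
      ∑ k ∈ Finset.Icc 1 N, C (starRingEnd ℂ (c (n * N + m) (N + m - (N + m - k)))) *
        (if N ≤ n * N + (N + m - k) then p (n * N + (N + m - k) - N) else 0) := by
    refine Finset.sum_congr rfl fun k hk => ?_
    rw [Finset.mem_Icc] at hk
    rw [show N + m - (N + m - k) = k by omega,
      show n * N + (N + m - k) - N = n * N + m - k by omega]
    simp only [show N ≤ n * N + (N + m - k) ↔ k ≤ n * N + m by omega]
  have e3 : ∑ l : Fin N, C (blockD N c (n + 1) m l) * p ((n + 1) * N + l) =
      ∑ l : Fin N, if l ≤ m then C (c (n * N + (N + l)) (N + l - m)) * p (n * N + (N + l))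
        else 0 := by
    refine Finset.sum_congr rfl fun l _ => ?_
    simp only [blockD, Matrix.of_apply]
    rcases le_or_gt l m with h | h
    · rw [if_neg h.not_gt, if_pos h, add_mul, one_mul, add_assoc]
    · rw [if_pos h, if_neg h.not_ge, C_0, zero_mul]
  have e4 : (if n = 0 then 0 else ∑ l : Fin N, C ((blockD N c n)ᴴ m l) * p ((n - 1) * N + l)) =
      ∑ l : Fin N, if m ≤ l then C (starRingEnd ℂ (c (n * N + m) (N + m - l))) *
        (if N ≤ n * N + l then p (n * N + l - N) else 0) else 0 := by
    cases n with
    | zero =>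
      rw [if_pos rfl, Finset.sum_eq_zero]
      intro l _
      rw [if_neg (c := N ≤ 0 * N + l) (by have := l.2; omega), mul_zero, ite_self]
    | succ n =>
      rw [if_neg n.succ_ne_zero]
      refine Finset.sum_congr rfl fun l _ => ?_
      simp only [blockD, Matrix.conjTranspose_apply, Matrix.of_apply]
      rcases le_or_gt m l with h | h
      · rw [if_neg h.not_gt, if_pos h, if_pos (by rw [add_mul]; omega), RCLike.star_def,
          Nat.add_sub_cancel, show (n + 1) * N + l - N = n * N + l by rw [add_mul]; omega]
      · rw [if_pos h, if_neg h.not_ge, star_zero, C_0, zero_mul]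
  have e5 : ∑ l : Fin N, C (blockE N c n m l) * p (n * N + l) =
      (∑ l : Fin N, if l = m then C (c (n * N + m) 0) * p (n * N + m) else 0) +
      (∑ l : Fin N, if m < l then C (c (n * N + l) (l - m)) * p (n * N + l) else 0) +
      ∑ l : Fin N, if l < m then C (starRingEnd ℂ (c (n * N + m) (N + m - (N + l)))) *
        (if N ≤ n * N + (N + l) then p (n * N + (N + l) - N) else 0) else 0 := by
    rw [← Finset.sum_add_distrib, ← Finset.sum_add_distrib]
    refine Finset.sum_congr rfl fun l _ => ?_
    simp only [blockE, Matrix.of_apply]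
    rcases lt_trichotomy m l with h | rfl | h
    · rw [if_pos h.le, if_neg h.ne', if_pos h, if_neg h.not_gt]
      simp
    · simp
    · rw [if_neg h.not_ge, if_neg h.ne, if_neg h.not_gt, if_pos h,
        if_pos (show N ≤ n * N + (N + l) by omega), show N + m - (N + l) = (m - l : ℕ) by omega,
        show n * N + (N + l) - N = n * N + l by omega]
      simp
  rw [e1, e2, hup, hdown, e3, e4, e5, Finset.sum_ite_eq' Finset.univ m,
    if_pos (Finset.mem_univ m)]
  abel

/-! ### Expansions in powers of `h` -/

section Expansion

variable {N : ℕ}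

/-- The polynomial `∑_{j < N} x^j f_j(h(x))`. -/
noncomputable def powerSum (h : ℂ[X]) : (Fin N → ℂ[X]) →ₗ[ℂ] ℂ[X] where
  toFun f := ∑ j : Fin N, X ^ (j : ℕ) * (f j).comp h
  map_add' f g := by simp [mul_add, Finset.sum_add_distrib]
  map_smul' c f := by simp [Finset.smul_sum, smul_comp]

theorem powerSum_apply (h : ℂ[X]) (f : Fin N → ℂ[X]) :
    powerSum h f = ∑ j : Fin N, X ^ (j : ℕ) * (f j).comp h := rfl

theorem powerSum_X_mul (h : ℂ[X]) (f : Fin N → ℂ[X]) :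
    powerSum h (fun j => X * f j) = h * powerSum h f := by
  rw [powerSum_apply, powerSum_apply, Finset.mul_sum]
  refine Finset.sum_congr rfl fun j _ => ?_
  rw [mul_comp, X_comp]
  ring

theorem powerSum_injective [NeZero N] {h : ℂ[X]} (hh : h.natDegree = N) :
    Function.Injective (powerSum h : (Fin N → ℂ[X]) → ℂ[X]) := by
  intro f g hfg
  ext1 j
  rw [← hComponent_unique h hh (NeZero.pos N) f j, ← hComponent_unique h hh (NeZero.pos N) g j]
  exact congrArg (hComponent h j) hfg

theorem powerSum_constMatrix_mul (h : ℂ[X]) (A : Matrix (Fin N) (Fin N) ℂ)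
    (P : Matrix (Fin N) (Fin N) ℂ[X]) (m : Fin N) :
    powerSum h ((constMatrix A * P) m) = ∑ l, C (A m l) * powerSum h (P l) := by
  have : (constMatrix A * P) m = ∑ l, A m l • P l := by
    ext1 j
    simp [constMatrix_mul_apply, smul_eq_C_mul]
  rw [this, map_sum]
  simp [smul_eq_C_mul]

/-- The matrix recurrence with the block coefficients, read in the rows of index `m`, is the
scalar recurrence at the indices `nN + m`. -/
theorem X_smul_eq_iff_band [NeZero N] {h : ℂ[X]} (hh : h.natDegree = N) (c : ℕ → ℕ → ℂ)
    {p : ℕ → ℂ[X]} {P : ℕ → Matrix (Fin N) (Fin N) ℂ[X]}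
    (hp : ∀ n (m : Fin N), p (n * N + m) = powerSum h (P n m)) (n : ℕ) :
    ((X : ℂ[X]) • P n = constMatrix (blockD N c (n + 1)) * P (n + 1) +
      constMatrix (blockE N c n) * P n +
      if n = 0 then 0 else constMatrix (blockD N c n)ᴴ * P (n - 1)) ↔
    ∀ m : Fin N, h * p (n * N + m) = C (c (n * N + m) 0) * p (n * N + m) +
      ∑ k ∈ Finset.Icc 1 N, (C (starRingEnd ℂ (c (n * N + m) k)) *
        (if k ≤ n * N + m then p (n * N + m - k) else 0) +
        C (c (n * N + m + k) k) * p (n * N + m + k)) := by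
  have key : ∀ m : Fin N, ((X : ℂ[X]) • P n) m = (constMatrix (blockD N c (n + 1)) * P (n + 1) +
      constMatrix (blockE N c n) * P n +
      if n = 0 then 0 else constMatrix (blockD N c n)ᴴ * P (n - 1)) m ↔
      h * p (n * N + m) = C (c (n * N + m) 0) * p (n * N + m) +
      ∑ k ∈ Finset.Icc 1 N, (C (starRingEnd ℂ (c (n * N + m) k)) *
        (if k ≤ n * N + m then p (n * N + m - k) else 0) +
        C (c (n * N + m + k) k) * p (n * N + m + k)) := by
    intro m
    rw [← (powerSum_injective hh).eq_iff, band_sum_eq_block_sum]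
    have h1 : powerSum h (((X : ℂ[X]) • P n) m) = h * p (n * N + m) := by
      rw [hp]
      exact powerSum_X_mul h (P n m)
    have h2 : powerSum h ((if n = 0 then (0 : Matrix (Fin N) (Fin N) ℂ[X])
        else constMatrix (blockD N c n)ᴴ * P (n - 1)) m) =
        if n = 0 then 0 else ∑ l : Fin N, C ((blockD N c n)ᴴ m l) * p ((n - 1) * N + l) := by
      split_ifs
      · exact map_zero (powerSum h)
      · rw [powerSum_constMatrix_mul]
        simp only [hp]
    have h3 : ∀ A B D : Matrix (Fin N) (Fin N) ℂ[X], powerSum h ((A + B + D) m) =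
        powerSum h (A m) + powerSum h (B m) + powerSum h (D m) := fun A B D => by
      rw [← map_add, ← map_add]
      rfl
    rw [h1, h3, h2, powerSum_constMatrix_mul, powerSum_constMatrix_mul]
    simp only [hp]
  constructor
  · intro H m
    exact (key m).1 (congrFun H m)
  · intro H
    exact funext fun m => (key m).2 (H m)

end Expansion

/-! ### Scalar and matrix recurrences -/

section Recurrences

variable {N : ℕ}

theorem Matrix.IsLowerTriangular.det_ne_zero_iff {A : Matrix (Fin N) (Fin N) ℂ}
    (hA : A.IsLowerTriangular) : A.det ≠ 0 ↔ ∀ i, A i i ≠ 0 := by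
  rw [Matrix.det_of_isLowerTriangular A hA, Finset.prod_ne_zero_iff]
  simp

theorem blockD_isLowerTriangular (c : ℕ → ℕ → ℂ) (n : ℕ) :
    (blockD N c n).IsLowerTriangular := fun i l h => by
  have h' : i < l := h
  simp [blockD, h']

theorem blockE_isHermitian {c : ℕ → ℕ → ℂ} (hc : ∀ n, (c n 0).im = 0) (n : ℕ) :
    (blockE N c n).IsHermitian := by
  refine Matrix.IsHermitian.ext fun i j => ?_
  simp only [blockE, Matrix.of_apply]
  rcases lt_trichotomy i j with h | rfl | h
  · simp [h.le, h.not_ge]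
  · simpa using Complex.conj_eq_iff_im.2 (hc _)
  · simp [h.le, h.not_ge]

/-- The two parts of the matrix recurrence as one equation with a case distinction. -/
theorem forall_X_smul_eq_iff {P : ℕ → Matrix (Fin N) (Fin N) ℂ[X]}
    {D E : ℕ → Matrix (Fin N) (Fin N) ℂ} :
    (∀ n, (X : ℂ[X]) • P n = constMatrix (D (n + 1)) * P (n + 1) + constMatrix (E n) * P n +
      if n = 0 then 0 else constMatrix (D n)ᴴ * P (n - 1)) ↔
    ((X : ℂ[X]) • P 0 = constMatrix (D 1) * P 1 + constMatrix (E 0) * P 0) ∧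
    ∀ n, (X : ℂ[X]) • P (n + 1) = constMatrix (D (n + 2)) * P (n + 2) +
      constMatrix (E (n + 1)) * P (n + 1) + constMatrix ((D (n + 1))ᴴ) * P n := by
  constructor
  · intro H
    exact ⟨by simpa using H 0, fun n => by simpa using H (n + 1)⟩
  · rintro ⟨H0, H⟩ (_ | n)
    · simpa using H0
    · simpa using H n

theorem sum_X_pow_mul_C_coeff {q : ℂ[X]} (hq : q.degree < N) :
    ∑ j : Fin N, X ^ (j : ℕ) * C (q.coeff j) = q := by
  rcases eq_or_ne q 0 with rfl | hq0
  · simp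
  rw [Fin.sum_univ_eq_sum_range (fun j => X ^ j * C (q.coeff j)) N]
  conv_rhs => rw [q.as_sum_range_C_mul_X_pow' ((natDegree_lt_iff_degree_lt hq0).2 hq)]
  exact Finset.sum_congr rfl fun j _ => mul_comm _ _

namespace ScalarRecurrence

variable {h : ℂ[X]} {c : ℕ → ℕ → ℂ} {p : ℕ → ℂ[X]}

/-- The term `c_{n+N,N} p_{n+N}` of the recurrence is `h p_n`, of degree `n + N`, up to terms of
smaller degree. -/
theorem degree_eq (hp : ScalarRecurrence N h c p) (hh : h.natDegree = N) (hN : 0 < N) (n : ℕ) :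
    (p n).degree = n := by
  induction n using Nat.strong_induction_on with
  | _ n ih =>
  by_cases hn : n < N
  · exact hp.init n hn
  obtain ⟨n, rfl⟩ : ∃ k, n = k + N := ⟨n - N, by omega⟩
  have hmem : ∀ k < n + N, p k ∈ degreeLT ℂ (n + N) := fun k hk => by
    rw [mem_degreeLT, ih k hk]
    exact_mod_cast hk
  have hrec := hp.rec_eq n
  set r := C (c n 0) * p n + ∑ k ∈ Finset.Icc 1 N,
    (C (starRingEnd ℂ (c n k)) * if k ≤ n then p (n - k) else 0) +
    ∑ k ∈ (Finset.Icc 1 N).erase N, C (c (n + k) k) * p (n + k) with hr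
  have hr_mem : r ∈ degreeLT ℂ (n + N) := by
    have hC : ∀ (a : ℂ) (q : ℂ[X]), q ∈ degreeLT ℂ (n + N) → C a * q ∈ degreeLT ℂ (n + N) :=
      fun a q hq => by
        rw [← smul_eq_C_mul]
        exact Submodule.smul_mem _ a hq
    refine add_mem (add_mem (hC _ _ (hmem n (by omega))) (sum_mem fun k hk => hC _ _ ?_))
      (sum_mem fun k hk => hC _ _ (hmem _ ?_))
    · split_ifs
      · exact hmem _ (by omega)
      · exact zero_mem _
    · rw [Finset.mem_erase, Finset.mem_Icc] at hk
      omega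
  have htop : C (c (n + N) N) * p (n + N) = h * p n - r := by
    rw [hrec, hr, Finset.sum_add_distrib, ← Finset.add_sum_erase (Finset.Icc 1 N)
      (fun k => C (c (n + k) k) * p (n + k)) (Finset.mem_Icc.2 ⟨hN, le_rfl⟩)]
    abel
  have hdeg : (h * p n).degree = (n + N : ℕ) := by
    rw [degree_mul, ih n (by omega), degree_eq_natDegree (by rintro rfl; simp at hh; omega), hh,
      add_comm]
    norm_cast
  rw [← degree_C_mul (p := p (n + N)) (hp.ne_zero (n + N)), htop,
    degree_sub_eq_left_of_degree_lt, hdeg]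
  rw [hdeg]
  exact mem_degreeLT.1 hr_mem

theorem toMatrixPolys_zero (hp : ScalarRecurrence N h c p) (hh : h.natDegree = N) :
    toMatrixPolys N h p 0 = constMatrix (Matrix.of fun m j : Fin N => (p m).coeff j) := by
  refine Matrix.ext fun m j => ?_
  simp only [toMatrixPolys, constMatrix, Matrix.of_apply, Matrix.map_apply, zero_mul, zero_add]
  have h1 := hComponent_unique h hh m.pos (fun i : Fin N => C ((p m).coeff i)) j
  simp only [C_comp] at h1
  rwa [sum_X_pow_mul_C_coeff] at h1
  rw [hp.init m m.2]
  exact_mod_cast m.2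

theorem coeff_isLowerTriangular (hp : ScalarRecurrence N h c p) :
    (Matrix.of fun m j : Fin N => (p m).coeff j).IsLowerTriangular := fun i j hij => by
  have hij' : i < j := hij
  refine coeff_eq_zero_of_degree_lt ?_
  rw [hp.init i i.2]
  exact_mod_cast hij'

theorem matrixRecurrence [NeZero N] (hp : ScalarRecurrence N h c p) (hh : h.natDegree = N) :
    MatrixRecurrence (toMatrixPolys N h p) (blockD N c) (blockE N c) := by
  have hrec := forall_X_smul_eq_iff.1 fun n =>
    (X_smul_eq_iff_band hh c (P := toMatrixPolys N h p)
      (fun n m => (sum_hComponent h hh (NeZero.pos N) _).symm) n).2 fun m => hp.rec_eq _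
  refine ⟨⟨_, ?_, hp.toMatrixPolys_zero hh⟩, blockE_isHermitian hp.real, fun n _ => ?_, hrec.1,
    hrec.2⟩
  · rw [hp.coeff_isLowerTriangular.det_ne_zero_iff]
    exact fun m => coeff_ne_zero_of_eq_degree (hp.init m m.2)
  · rw [(blockD_isLowerTriangular c n).det_ne_zero_iff]
    intro i
    simpa [blockD] using hp.ne_zero (n * N + i)

theorem matCoeff_isLowerTriangular [NeZero N] (hp : ScalarRecurrence N h c p)
    (hh : h.natDegree = N) (n : ℕ) :
    (matCoeff n (toMatrixPolys N h p n)).IsLowerTriangular := by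
  refine (hp.matrixRecurrence hh).matCoeff_isLowerTriangular ?_
    (fun n _ => blockD_isLowerTriangular c n) n
  rw [hp.toMatrixPolys_zero hh]
  have := hp.coeff_isLowerTriangular
  intro i j hij
  simpa [matCoeff, constMatrix] using this hij

end ScalarRecurrence

/-- The coefficients of the banded matrix with the blocks `D_n` and `E_n`: the inverse of the
passage from `c` to `blockD N c` and `blockE N c`.  The entries `c_{q,k}` with `q < k` multiply
`p_{q-k} = 0` in the recurrence; they are given the value `1`, so that `c_{q,N} ≠ 0`. -/
noncomputable def bandCoeff [NeZero N] (D E : ℕ → Matrix (Fin N) (Fin N) ℂ) (q k : ℕ) : ℂ :=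
  if k ≤ q % N then E (q / N) (Fin.ofNat N (q % N - k)) (Fin.ofNat N q)
  else if q / N = 0 then 1 else D (q / N) (Fin.ofNat N (N + q % N - k)) (Fin.ofNat N q)

theorem bandCoeff_of_le [NeZero N] (D E : ℕ → Matrix (Fin N) (Fin N) ℂ) (n : ℕ) {i l : Fin N}
    (h : i ≤ l) : bandCoeff D E (n * N + l) (l - i) = E n i l := by
  have h1 : (n * N + l) % N = l := by
    rw [Nat.mul_add_mod_of_lt l.2]
  have h2 : (n * N + l) / N = n := by
    rw [mul_comm, Nat.mul_add_div (NeZero.pos N), Nat.div_eq_of_lt l.2, add_zero]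
  have h3 : Fin.ofNat N (n * N + l) = l := Fin.ext h1
  have h4 : Fin.ofNat N (l - (l - i)) = i := by
    rw [Nat.sub_sub_self h]
    exact Fin.ext (Nat.mod_eq_of_lt i.2)
  rw [bandCoeff, h1, h2, h3, if_pos (Nat.sub_le _ _), h4]

theorem bandCoeff_add [NeZero N] (D E : ℕ → Matrix (Fin N) (Fin N) ℂ) (n : ℕ) (i l : Fin N) :
    bandCoeff D E (n * N + l) (N + l - i) = if n = 0 then 1 else D n i l := by
  have hi := i.2
  have h1 : (n * N + l) % N = l := by
    rw [Nat.mul_add_mod_of_lt l.2]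
  have h2 : (n * N + l) / N = n := by
    rw [mul_comm, Nat.mul_add_div (NeZero.pos N), Nat.div_eq_of_lt l.2, add_zero]
  have h3 : Fin.ofNat N (n * N + l) = l := Fin.ext h1
  have h4 : Fin.ofNat N (N + l - (N + l - i)) = i := by
    rw [Nat.sub_sub_self (by omega)]
    exact Fin.ext (Nat.mod_eq_of_lt i.2)
  rw [bandCoeff, h1, h2, h3, if_neg (by omega), h4]

theorem blockE_bandCoeff [NeZero N] {D E : ℕ → Matrix (Fin N) (Fin N) ℂ} {n : ℕ}
    (hE : (E n).IsHermitian) : blockE N (bandCoeff D E) n = E n := by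
  ext i l
  simp only [blockE, Matrix.of_apply]
  split_ifs with h
  · exact bandCoeff_of_le D E n h
  · rw [bandCoeff_of_le D E n (not_le.1 h).le]
    exact hE.apply i l

theorem blockD_bandCoeff [NeZero N] {D E : ℕ → Matrix (Fin N) (Fin N) ℂ} {n : ℕ} (hn : 1 ≤ n)
    (hD : (D n).IsLowerTriangular) : blockD N (bandCoeff D E) n = D n := by
  ext i l
  simp only [blockD, Matrix.of_apply]
  split_ifs with h
  · exact (hD h).symm
  · rw [bandCoeff_add, if_neg (by omega)]

namespace MatrixRecurrence

variable [NeZero N] {h : ℂ[X]} {P : ℕ → Matrix (Fin N) (Fin N) ℂ[X]}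
  {D E : ℕ → Matrix (Fin N) (Fin N) ℂ}

theorem scalarRecurrence (hP : MatrixRecurrence P D E) (hh : h.natDegree = N)
    (hL : ∀ n, (matCoeff n (P n)).IsLowerTriangular) :
    ScalarRecurrence N h (bandCoeff D E) (toScalarPolys h P) := by
  have hD := fun n hn => hP.isLowerTriangular_of_matCoeff hL (n := n) hn
  have hdiv : ∀ q, ∃ n, ∃ m : Fin N, q = n * N + m := fun q =>
    ⟨q / N, ⟨q % N, Nat.mod_lt _ (NeZero.pos N)⟩, (Nat.div_add_mod' q N).symm⟩
  refine ⟨?_, ?_, ?_, ?_⟩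
  · intro k hk
    obtain ⟨A, hA, hP0⟩ := hP.init
    have hA0 : matCoeff 0 (P 0) = A := by
      ext
      simp [hP0, matCoeff, constMatrix]
    have hAL := hL 0
    rw [hA0] at hAL
    have h1 := toScalarPolys_apply h P 0 ⟨k, hk⟩
    simp only [zero_mul, zero_add, hP0, constMatrix, Matrix.map_apply, C_comp] at h1
    have hcoeff : ∀ i : Fin N, (toScalarPolys h P k).coeff i = A ⟨k, hk⟩ i := by
      intro i
      rw [h1, finsetSum_coeff, Finset.sum_eq_single i]
      · simp
      · intro j _ hj
        rw [coeff_mul_C, coeff_X_pow, if_neg (fun e => hj (Fin.ext e.symm)), zero_mul]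
      · simp
    refine degree_eq_of_le_of_coeff_ne_zero ?_ ?_
    · rw [h1]
      refine (degree_sum_le _ _).trans (Finset.sup_le fun j _ => ?_)
      rcases le_or_gt (j : ℕ) k with hjk | hjk
      · rw [mul_comm]
        exact (degree_C_mul_X_pow_le _ _).trans (by exact_mod_cast hjk)
      · rw [hAL (show (⟨k, hk⟩ : Fin N) < j from hjk)]
        simp
    · exact (hcoeff ⟨k, hk⟩).trans_ne (hAL.det_ne_zero_iff.1 hA _)
  · intro q
    obtain ⟨n, m, rfl⟩ := hdiv q
    have h1 := bandCoeff_of_le D E n (le_refl m)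
    rw [Nat.sub_self] at h1
    rw [h1]
    exact Complex.conj_eq_iff_im.1 ((hP.hermitian n).apply m m)
  · intro q
    obtain ⟨n, m, rfl⟩ := hdiv q
    have h1 := bandCoeff_add D E n m m
    rw [Nat.add_sub_cancel] at h1
    rw [h1]
    split_ifs with hn
    · exact one_ne_zero
    · have hn' : 1 ≤ n := Nat.one_le_iff_ne_zero.2 hn
      exact (hD n hn').det_ne_zero_iff.1 (hP.det_ne_zero n hn') m
  · intro q
    obtain ⟨n, m, rfl⟩ := hdiv q
    refine (X_smul_eq_iff_band hh _ (P := P) (fun n m => toScalarPolys_apply h P n m) n).1 ?_ m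
    have h1 := forall_X_smul_eq_iff.2 ⟨hP.rec_zero, hP.rec_succ⟩ n
    rw [blockE_bandCoeff (hP.hermitian n), blockD_bandCoeff n.succ_pos (hD _ n.succ_pos)]
    rcases eq_or_ne n 0 with rfl | hn
    · rwa [if_pos rfl] at h1 ⊢
    · have hn' : 1 ≤ n := Nat.one_le_iff_ne_zero.2 hn
      rw [blockD_bandCoeff hn' (hD n hn')]
      exact h1

end MatrixRecurrence

end Recurrences

/-! ### Weak limits of measures with uniformly bounded second moments -/

section WeakLimit

open Filter Topology
open scoped ENNReal NNReal BoundedContinuousFunction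

variable {Ω F G : Type*} [NormedAddCommGroup Ω]
  [NormedAddCommGroup F] [NormedAddCommGroup G] {f : Ω → ℂ} {K : ℝ≥0}

/-- The truncation `f / (1 + ε ‖f‖)` of a continuous function to a bounded continuous one. -/
noncomputable def truncation (hf : Continuous f) {ε : ℝ} (hε : 0 < ε) : Ω →ᵇ ℂ :=
  BoundedContinuousFunction.ofNormedAddCommGroup (fun z => f z / (1 + ε * ‖f z‖ : ℝ))
    (by
      refine hf.div (by fun_prop) fun z => ?_
      have : 0 < 1 + ε * ‖f z‖ := by positivity
      exact_mod_cast this.ne') ε⁻¹ fun z => by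
    have h1 : 0 < 1 + ε * ‖f z‖ := by positivity
    rw [norm_div, Complex.norm_real, Real.norm_of_nonneg h1.le, div_le_iff₀ h1, mul_add,
      inv_mul_cancel_left₀ hε.ne']
    linarith [inv_pos.2 hε]

theorem norm_sub_truncation_le (hf : Continuous f) {ε : ℝ} (hε : 0 < ε) (z : Ω) :
    ‖f z - truncation hf hε z‖ ≤ ε * ‖f z‖ ^ 2 := by
  have h1 : 0 < 1 + ε * ‖f z‖ := by positivity
  have h2 : f z - truncation hf hε z = (ε * ‖f z‖ / (1 + ε * ‖f z‖) : ℝ) * f z := by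
    have h3 : ((1 + ε * ‖f z‖ : ℝ) : ℂ) ≠ 0 := by exact_mod_cast h1.ne'
    change f z - f z / (1 + ε * ‖f z‖ : ℝ) = _
    rw [Complex.ofReal_div]
    field_simp
    push_cast
    ring
  rw [h2, norm_mul, Complex.norm_real, Real.norm_of_nonneg (by positivity), pow_two, ← mul_assoc]
  gcongr
  exact div_le_self (by positivity) (by linarith [show 0 ≤ ε * ‖f z‖ by positivity])

variable [MeasurableSpace Ω]

/-- A continuous function whose norm in `L²(ν n)` is bounded uniformly for all large `n`. -/
structure L2Bounded (ν : ℕ → FiniteMeasure Ω) (f : Ω → F) : Prop where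
  continuous : Continuous f
  bound : ∃ K : ℝ≥0, ∀ᶠ n in atTop, ∫⁻ z, ‖f z‖ₑ ^ 2 ∂(ν n : Measure Ω) ≤ K

namespace L2Bounded

variable {ν : ℕ → FiniteMeasure Ω}

theorem mono {f : Ω → F} {g : Ω → G} (hf : L2Bounded ν f) (hg : Continuous g)
    (h : ∀ n, ∀ᵐ z ∂(ν n : Measure Ω), ‖g z‖ ≤ ‖f z‖) : L2Bounded ν g := by
  obtain ⟨K, hK⟩ := hf.bound
  refine ⟨hg, K, ?_⟩
  filter_upwards [hK] with n hn
  refine (lintegral_mono_ae ?_).trans hn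
  filter_upwards [h n] with z hz
  gcongr
  exact enorm_le_iff_norm_le.2 hz

theorem add [BorelSpace Ω] {f g : Ω → F} (hf : L2Bounded ν f) (hg : L2Bounded ν g) :
    L2Bounded ν fun z => f z + g z := by
  obtain ⟨K, hK⟩ := hf.bound
  obtain ⟨L, hL⟩ := hg.bound
  refine ⟨hf.continuous.add hg.continuous, 2 * (K + L), ?_⟩
  filter_upwards [hK, hL] with n hn hn'
  have hle : ∀ z, ‖f z + g z‖ₑ ^ 2 ≤ 2 * (‖f z‖ₑ ^ 2 + ‖g z‖ₑ ^ 2) := fun z => by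
    have h1 : ‖f z + g z‖₊ ^ 2 ≤ 2 * (‖f z‖₊ ^ 2 + ‖g z‖₊ ^ 2) :=
      (pow_le_pow_left₀ zero_le (nnnorm_add_le _ _) 2).trans add_sq_le
    simp only [enorm_eq_nnnorm]
    exact_mod_cast h1
  refine (lintegral_mono hle).trans ?_
  have hmeas : Measurable fun z => ‖f z‖ₑ ^ 2 := (hf.continuous.enorm.measurable).pow_const 2
  rw [lintegral_const_mul' _ _ (by simp), lintegral_add_left hmeas]
  push_cast
  gcongr

theorem const_mul {f : Ω → ℂ} (hf : L2Bounded ν f) (c : ℂ) : L2Bounded ν fun z => c * f z := by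
  obtain ⟨K, hK⟩ := hf.bound
  refine ⟨continuous_const.mul hf.continuous, ‖c‖₊ ^ 2 * K, ?_⟩
  filter_upwards [hK] with n hn
  simp only [enorm_mul, mul_pow]
  rw [lintegral_const_mul' _ _ (by simp)]
  push_cast
  rw [enorm_eq_nnnorm]
  gcongr

theorem sum [BorelSpace Ω] {ι : Type*} {s : Finset ι} {f : ι → Ω → F} (hf : ∀ i ∈ s, L2Bounded ν (f i)) :
    L2Bounded ν fun z => ∑ i ∈ s, f i z := by
  classical
  induction s using Finset.induction_on with
  | empty => exact ⟨by simpa using continuous_const, 0, by simp⟩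
  | insert a s ha ih =>
    simp only [Finset.sum_insert ha]
    exact (hf a (Finset.mem_insert_self a s)).add
      (ih fun i hi => hf i (Finset.mem_insert_of_mem hi))

theorem pi [BorelSpace Ω] {ι : Type*} [Fintype ι] {f : Ω → ι → ℂ}
    (hf : ∀ i, L2Bounded ν fun z => f z i) : L2Bounded ν f := by
  have h1 : L2Bounded ν fun z => ∑ i, ‖f z i‖ :=
    sum fun i _ => (hf i).mono (hf i).continuous.norm fun n => ae_of_all _ fun z => by simp
  refine h1.mono (continuous_pi fun i => (hf i).continuous) fun n => ae_of_all _ fun z => ?_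
  rw [Real.norm_of_nonneg (Finset.sum_nonneg fun i _ => norm_nonneg _)]
  exact (pi_norm_le_iff_of_nonneg (Finset.sum_nonneg fun i _ => norm_nonneg _)).2 fun i =>
    Finset.single_le_sum (f := fun i => ‖f z i‖) (fun i _ => norm_nonneg _) (Finset.mem_univ i)

end L2Bounded

theorem integrable_of_lintegral_sq_le [BorelSpace Ω] {μ : Measure Ω} [IsFiniteMeasure μ]
    (hf : Continuous f) (h : ∫⁻ z, ‖f z‖ₑ ^ 2 ∂μ ≤ K) :
    Integrable f μ := by
  refine ⟨hf.aestronglyMeasurable, ?_⟩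
  have hle : ∀ z, ‖f z‖ₑ ≤ 1 + ‖f z‖ₑ ^ 2 := fun z => by
    rcases le_total ‖f z‖ₑ 1 with h | h
    · exact h.trans le_self_add
    · exact (le_self_pow₀ h two_ne_zero).trans le_add_self
  refine (lintegral_mono hle).trans_lt ?_
  rw [lintegral_add_left measurable_const, lintegral_one]
  exact ENNReal.add_lt_top.2 ⟨measure_lt_top μ _, h.trans_lt ENNReal.coe_lt_top⟩

theorem norm_integral_sub_truncation_le [BorelSpace Ω] {μ : Measure Ω} [IsFiniteMeasure μ]
    (hf : Continuous f) {ε : ℝ} (hε : 0 < ε)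
    (h : ∫⁻ z, ‖f z‖ₑ ^ 2 ∂μ ≤ K) :
    ‖∫ z, f z ∂μ - ∫ z, truncation hf hε z ∂μ‖ ≤ ε * K := by
  rw [← integral_sub (integrable_of_lintegral_sq_le hf h) ((truncation hf hε).integrable μ)]
  have h1 : ‖∫ z, (f z - truncation hf hε z) ∂μ‖ₑ ≤ ENNReal.ofReal ε * K := by
    refine (enorm_integral_le_lintegral_enorm _).trans ?_
    refine (lintegral_mono (g := fun z => ENNReal.ofReal ε * ‖f z‖ₑ ^ 2) fun z => ?_).trans ?_
    · beta_reduce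
      rw [← ofReal_norm, ← ofReal_norm (f z), ← ENNReal.ofReal_pow (norm_nonneg _),
        ← ENNReal.ofReal_mul hε.le]
      exact ENNReal.ofReal_le_ofReal (norm_sub_truncation_le hf hε z)
    · rw [lintegral_const_mul' _ _ ENNReal.ofReal_ne_top]
      gcongr
  rw [← ofReal_norm, ← ENNReal.ofReal_coe_nnreal, ← ENNReal.ofReal_mul hε.le] at h1
  exact (ENNReal.ofReal_le_ofReal_iff (by positivity)).1 h1

/-- Lower semicontinuity of the second moment under weak convergence: it is the supremum of the
integrals of the bounded continuous functions `min (‖f‖ ^ 2) j`. -/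
theorem lintegral_sq_le_of_tendsto [BorelSpace Ω] {ι : Type*} {l : Filter ι} [l.NeBot]
    {ν : ι → FiniteMeasure Ω} {μ : FiniteMeasure Ω} (hμ : Tendsto ν l (𝓝 μ)) (hf : Continuous f)
    (h : ∀ᶠ i in l, ∫⁻ z, ‖f z‖ₑ ^ 2 ∂(ν i : Measure Ω) ≤ K) :
    ∫⁻ z, ‖f z‖ₑ ^ 2 ∂(μ : Measure Ω) ≤ K := by
  let g : ℕ → Ω →ᵇ ℝ≥0 := fun j => BoundedContinuousFunction.mkOfBound
    ⟨fun z => min (‖f z‖₊ ^ 2) j, by fun_prop⟩ j fun x y => by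
      rw [NNReal.dist_eq]
      exact abs_sub_le_of_nonneg_of_le (NNReal.coe_nonneg _)
        (by exact_mod_cast min_le_right _ _) (NNReal.coe_nonneg _)
        (by exact_mod_cast min_le_right _ _)
  have hg : ∀ j, ∫⁻ z, g j z ∂(μ : Measure Ω) ≤ K := fun j => by
    refine le_of_tendsto (FiniteMeasure.tendsto_iff_forall_lintegral_tendsto.1 hμ (g j)) ?_
    filter_upwards [h] with n hn
    refine (lintegral_mono fun z => ?_).trans hn
    have h1 : g j z ≤ ‖f z‖₊ ^ 2 := min_le_left _ _
    exact (ENNReal.coe_le_coe.2 h1).trans_eq (ENNReal.coe_pow _ _)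
  refine le_of_tendsto' (lintegral_tendsto_of_tendsto_of_monotone
    (f := fun j z => (g j z : ℝ≥0∞)) (fun j => ?_) (ae_of_all _ fun z i j hij => ?_)
    (ae_of_all _ fun z => ?_)) hg
  · exact (g j).continuous.measurable.coe_nnreal_ennreal.aemeasurable
  · exact ENNReal.coe_le_coe.2 (min_le_min_left _ (Nat.cast_le.2 hij))
  · refine tendsto_const_nhds.congr' ?_
    obtain ⟨k, hk⟩ := exists_nat_ge (‖f z‖₊ ^ 2)
    filter_upwards [eventually_ge_atTop k] with j hj
    have h1 : g j z = ‖f z‖₊ ^ 2 := min_eq_left (hk.trans (Nat.cast_le.2 hj))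
    rw [h1, enorm_eq_nnnorm]
    norm_cast

/-- The bound on the second moments makes the truncation error `O(ε)` uniformly in the measure, so
the integral of the unbounded function `f` passes to the weak limit. -/
theorem integral_eq_of_tendsto [BorelSpace Ω] {ι : Type*} {l : Filter ι} [l.NeBot]
    {ν : ι → FiniteMeasure Ω} {μ : FiniteMeasure Ω} (hμ : Tendsto ν l (𝓝 μ)) (hf : Continuous f)
    (h : ∀ᶠ i in l, ∫⁻ z, ‖f z‖ₑ ^ 2 ∂(ν i : Measure Ω) ≤ K) {c : ℂ}
    (hc : ∀ᶠ i in l, ∫ z, f z ∂(ν i : Measure Ω) = c) : ∫ z, f z ∂(μ : Measure Ω) = c := by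
  have hle : ∀ ε : ℝ, 0 < ε → ‖∫ z, f z ∂(μ : Measure Ω) - c‖ ≤ ε * (2 * K) := by
    intro ε hε
    have h1 := norm_integral_sub_truncation_le hf hε (lintegral_sq_le_of_tendsto hμ hf h)
    have h2 : ‖∫ z, truncation hf hε z ∂(μ : Measure Ω) - c‖ ≤ ε * K := by
      have h3 := (FiniteMeasure.tendsto_iff_forall_integral_rclike_tendsto ℂ).1 hμ
        (truncation hf hε)
      refine le_of_tendsto (h3.sub_const c).norm ?_
      filter_upwards [h, hc] with n hn hn'
      rw [← hn', norm_sub_rev]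
      exact norm_integral_sub_truncation_le hf hε hn
    calc ‖∫ z, f z ∂(μ : Measure Ω) - c‖ ≤ _ := norm_sub_le_norm_sub_add_norm_sub _
          (∫ z, truncation hf hε z ∂(μ : Measure Ω)) _
      _ ≤ ε * (2 * K) := by linarith
  rw [← sub_eq_zero, ← norm_le_zero_iff]
  refine le_of_forall_pos_le_add fun δ hδ => ?_
  have hpos : (0 : ℝ) < 2 * K + 1 := by positivity
  refine (hle (δ / (2 * K + 1)) (by positivity)).trans ?_
  rw [zero_add, div_mul_eq_mul_div, div_le_iff₀ hpos]
  nlinarith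

/-- A sequence of finite measures with bounded masses and second moments has a weak limit point,
by Prokhorov's theorem. -/
theorem exists_ultrafilter_tendsto [BorelSpace Ω] [ProperSpace Ω] {ν : ℕ → FiniteMeasure Ω}
    (h_one : L2Bounded ν fun _ => (1 : ℝ)) (h_norm : L2Bounded ν fun z : Ω => ‖z‖) :
    ∃ (U : Ultrafilter ℕ) (μ : FiniteMeasure Ω), (U : Filter ℕ) ≤ atTop ∧ Tendsto ν U (𝓝 μ) := by
  obtain ⟨C, hC⟩ := h_one.bound
  obtain ⟨L, hL⟩ := h_norm.bound
  have hu : Tendsto (fun j : ℕ => L / ((j : ℝ≥0) + 1)) atTop (𝓝 0) := by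
    rw [← NNReal.tendsto_coe]
    simpa [div_eq_mul_inv] using
      (tendsto_one_div_add_atTop_nhds_zero_nat (𝕜 := ℝ)).const_mul (L : ℝ)
  have hcompact := isCompact_setOfPred_finiteMeasure_mass_le_compl_isCompact_le (E := Ω)
    (K := fun j : ℕ => Metric.closedBall 0 ((j : ℝ) + 1)) C hu
    (fun j => isCompact_closedBall _ _) (Or.inl inferInstance)
  have hmem : ∀ᶠ n in atTop, ν n ∈ {μ : FiniteMeasure Ω | μ.mass ≤ C ∧
      ∀ j : ℕ, μ (Metric.closedBall 0 ((j : ℝ) + 1))ᶜ ≤ L / ((j : ℝ≥0) + 1)} := by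
    filter_upwards [hC, hL] with n hn hn'
    -- the masses outside balls are controlled by Chebyshev's inequality
    refine ⟨?_, fun j => ?_⟩
    · have : (ν n : Measure Ω) Set.univ ≤ C := by simpa using hn
      rw [← FiniteMeasure.ennreal_mass] at this
      exact_mod_cast this
    · have h1 : (ν n : Measure Ω) (Metric.closedBall 0 ((j : ℝ) + 1))ᶜ ≤
          L / ((j + 1 : ℝ≥0) : ℝ≥0∞) := by
        refine (measure_mono fun z hz => ?_).trans ((meas_ge_le_lintegral_div
          (f := fun z => ‖‖z‖‖ₑ ^ 2) (μ := (ν n : Measure Ω)) (ε := ((j + 1 : ℝ≥0) : ℝ≥0∞))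
          (by fun_prop) (by positivity) (ENNReal.coe_ne_top)).trans (by gcongr))
        have hz' : (j : ℝ) + 1 < ‖z‖ := by simpa using hz
        have h2 : (j + 1 : ℝ≥0) ≤ ‖z‖₊ ^ 2 := by
          rw [← NNReal.coe_le_coe]
          push_cast
          nlinarith [(Nat.cast_nonneg j : (0 : ℝ) ≤ j)]
        simp only [Set.mem_ofPred_eq, enorm_eq_nnnorm, nnnorm_norm]
        exact_mod_cast h2
      rw [← ENNReal.coe_div (by positivity), ← FiniteMeasure.ennreal_coeFn_eq_coeFn_toMeasure] at h1
      exact ENNReal.coe_le_coe.1 h1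
  have hU : ((hyperfilter ℕ : Ultrafilter ℕ) : Filter ℕ) ≤ atTop := Nat.hyperfilter_le_atTop
  obtain ⟨μ, -, hμ⟩ := hcompact.ultrafilter_le_nhds ((hyperfilter ℕ).map ν)
    (by rw [Ultrafilter.coe_map, le_principal_iff]; exact hU hmem)
  exact ⟨hyperfilter ℕ, μ, hU, hμ⟩

/-- Under the bounds of `exists_ultrafilter_tendsto`, the integrals of `L²`-bounded continuous
functions pass to the weak limit. -/
theorem exists_weak_limit [BorelSpace Ω] [ProperSpace Ω] {ν : ℕ → FiniteMeasure Ω}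
    (h_one : L2Bounded ν fun _ => (1 : ℝ)) (h_norm : L2Bounded ν fun z : Ω => ‖z‖) :
    ∃ μ : FiniteMeasure Ω, ∀ f : Ω → ℂ, L2Bounded ν f →
      Integrable f (μ : Measure Ω) ∧
      ∀ c, (∀ᶠ n in atTop, ∫ z, f z ∂(ν n : Measure Ω) = c) →
        ∫ z, f z ∂(μ : Measure Ω) = c := by
  obtain ⟨U, μ, hU, hμ⟩ := exists_ultrafilter_tendsto h_one h_norm
  refine ⟨μ, fun f hf => ?_⟩
  obtain ⟨K, hK⟩ := hf.bound
  exact ⟨integrable_of_lintegral_sq_le hf.continuous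
    (lintegral_sq_le_of_tendsto hμ hf.continuous (hU hK)), fun c hc =>
    integral_eq_of_tendsto hμ hf.continuous (hU hK) (hU hc)⟩

end WeakLimit

/-! ### Truncated block Jacobi matrices -/

section Jacobi

variable {N : ℕ}

/-- The value of a matrix polynomial at a point. -/
noncomputable def evalMatrix (x : ℂ) :
    Matrix (Fin N) (Fin N) ℂ[X] →+* Matrix (Fin N) (Fin N) ℂ :=
  (evalRingHom x).mapMatrix

theorem evalMatrix_apply (x : ℂ) (P : Matrix (Fin N) (Fin N) ℂ[X]) (i j : Fin N) :
    evalMatrix x P i j = (P i j).eval x := rfl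

theorem evalMatrix_constMatrix (x : ℂ) (A : Matrix (Fin N) (Fin N) ℂ) :
    evalMatrix x (constMatrix A) = A := by
  ext i j
  simp [evalMatrix_apply, constMatrix]

theorem evalMatrix_X_smul (x : ℂ) (P : Matrix (Fin N) (Fin N) ℂ[X]) :
    evalMatrix x ((X : ℂ[X]) • P) = x • evalMatrix x P := by
  ext i j
  simp [evalMatrix_apply]

/-- The block tridiagonal matrix with the block rows `D_i^*, E_i, D_{i+1}` for `i ≤ n`. -/
def truncatedJacobi (D E : ℕ → Matrix (Fin N) (Fin N) ℂ) (n : ℕ) :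
    Matrix (Fin (n + 1) × Fin N) (Fin (n + 1) × Fin N) ℂ :=
  Matrix.of fun s t =>
    if (t.1 : ℕ) = s.1 + 1 then D (s.1 + 1) s.2 t.2
    else if (t.1 : ℕ) = s.1 then E s.1 s.2 t.2
    else if (t.1 : ℕ) + 1 = s.1 then (D s.1)ᴴ s.2 t.2 else 0

theorem truncatedJacobi_isHermitian {D E : ℕ → Matrix (Fin N) (Fin N) ℂ}
    (hE : ∀ n, (E n).IsHermitian) (n : ℕ) : (truncatedJacobi D E n).IsHermitian := by
  refine Matrix.IsHermitian.ext fun s t => ?_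
  simp only [truncatedJacobi, Matrix.of_apply]
  rcases lt_trichotomy (s.1 : ℕ) t.1 with h | h | h
  · by_cases h1 : (t.1 : ℕ) = s.1 + 1
    · rw [if_pos h1, if_neg (by omega), if_neg (by omega), if_pos h1.symm, h1,
        Matrix.conjTranspose_apply, star_star]
    · rw [if_neg h1, if_neg (by omega), if_neg (by omega), if_neg (by omega), if_neg (by omega),
        if_neg (by omega), star_zero]
  · rw [if_neg (by omega), if_pos h, if_neg (by omega), if_pos h.symm, ← h]
    exact (hE _).apply _ _
  · by_cases h1 : (s.1 : ℕ) = t.1 + 1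
    · rw [if_pos h1, if_neg (by omega), if_neg (by omega), if_pos h1.symm, h1,
        Matrix.conjTranspose_apply]
    · rw [if_neg h1, if_neg (by omega), if_neg (by omega), if_neg (by omega), if_neg (by omega),
        if_neg (by omega), star_zero]

/-- The blocks of a vector, extended by zero to all block indices. -/
def blockVec {n : ℕ} (w : Fin (n + 1) × Fin N → ℂ) (i : ℕ) : Fin N → ℂ :=
  fun b => if h : i < n + 1 then w (⟨i, h⟩, b) else 0

theorem truncatedJacobi_mulVec (D E : ℕ → Matrix (Fin N) (Fin N) ℂ) {n : ℕ}
    (w : Fin (n + 1) × Fin N → ℂ) (i : Fin (n + 1)) :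
    (fun a => (truncatedJacobi D E n *ᵥ w) (i, a)) =
      D (i + 1) *ᵥ blockVec w (i + 1) + E i *ᵥ blockVec w i +
        if (i : ℕ) = 0 then 0 else (D i)ᴴ *ᵥ blockVec w (i - 1) := by
  ext a
  have hw : ∀ (j : Fin (n + 1)) b, w (j, b) = blockVec w j b := fun j b => by
    simp [blockVec, j.2]
  have h1 : ∀ j : Fin (n + 1), ∑ b, truncatedJacobi D E n (i, a) (j, b) * w (j, b) =
      (if (j : ℕ) = i + 1 then (D (i + 1) *ᵥ blockVec w (i + 1)) a else 0) +
      (if (j : ℕ) = i then (E i *ᵥ blockVec w i) a else 0) +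
      (if (j : ℕ) + 1 = i then ((D i)ᴴ *ᵥ blockVec w (i - 1)) a else 0) := by
    intro j
    simp only [hw, truncatedJacobi, Matrix.of_apply]
    by_cases h1 : (j : ℕ) = i + 1
    · simp only [if_pos h1, if_neg (show ¬ (j : ℕ) = i by omega),
        if_neg (show ¬ (j : ℕ) + 1 = i by omega), add_zero]
      rw [h1]
      rfl
    by_cases h2 : (j : ℕ) = i
    · simp only [if_pos h2, if_neg h1, if_neg (show ¬ (j : ℕ) + 1 = i by omega), add_zero,
        zero_add]
      rw [h2]
      rfl
    by_cases h3 : (j : ℕ) + 1 = i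
    · simp only [if_pos h3, if_neg h1, if_neg h2, zero_add, show (i : ℕ) - 1 = j by omega]
      rfl
    · simp only [if_neg h1, if_neg h2, if_neg h3, zero_mul, Finset.sum_const_zero, add_zero]
  simp only [Matrix.mulVec, dotProduct, Fintype.sum_prod_type]
  rw [Finset.sum_congr rfl fun j _ => h1 j]
  simp only [Finset.sum_add_distrib, Pi.add_apply]
  rw [Fin.sum_univ_eq_sum_range
      (fun j => if j = (i : ℕ) + 1 then (D (i + 1) *ᵥ blockVec w (i + 1)) a else 0),
    Fin.sum_univ_eq_sum_range (fun j => if j = (i : ℕ) then (E i *ᵥ blockVec w i) a else 0),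
    Fin.sum_univ_eq_sum_range
      (fun j => if j + 1 = (i : ℕ) then ((D i)ᴴ *ᵥ blockVec w (i - 1)) a else 0),
    Finset.sum_ite_eq', Finset.sum_ite_eq', if_pos (Finset.mem_range.2 i.2)]
  congr 1
  · congr 1
    split_ifs with h
    · rfl
    · have : blockVec w (i + 1) = 0 := by
        ext b
        simpa [blockVec] using fun h' => absurd (Finset.mem_range.2 (by omega)) h
      change _ = (D (i + 1) *ᵥ blockVec w (i + 1)) a
      simp [this]
  · rcases Nat.eq_zero_or_pos (i : ℕ) with h | h
    · rw [if_pos h, Finset.sum_eq_zero fun j _ => if_neg (by omega)]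
      rfl
    · rw [if_neg h.ne', Finset.sum_eq_single ((i : ℕ) - 1)]
      · rw [if_pos (by omega)]
      · exact fun j _ hj => if_neg (by omega)
      · exact fun h' => absurd (Finset.mem_range.2 (by omega)) h'

namespace MatrixRecurrence

variable {P : ℕ → Matrix (Fin N) (Fin N) ℂ[X]} {D E : ℕ → Matrix (Fin N) (Fin N) ℂ}

/-- An eigenvector of the truncated block Jacobi matrix has the blocks `P_i(x) u`, because its
blocks satisfy the same recurrence. -/
theorem evalMatrix_mulVec_of_eigenvector (hP : MatrixRecurrence P D E) {n : ℕ} {x : ℂ}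
    {w : Fin (n + 1) × Fin N → ℂ} (hw : truncatedJacobi D E n *ᵥ w = x • w) {i : ℕ}
    (hi : i ≤ n) :
    evalMatrix x (P i) *ᵥ ((evalMatrix x (P 0))⁻¹ *ᵥ blockVec w 0) = blockVec w i := by
  induction i using Nat.strong_induction_on with
  | _ i ih =>
  cases i with
  | zero =>
    obtain ⟨A, hA, hA0⟩ := hP.init
    rw [Matrix.mulVec_mulVec, hA0, evalMatrix_constMatrix, Matrix.mul_nonsing_inv _ hA.isUnit,
      Matrix.one_mulVec]
  | succ i =>
    set u := (evalMatrix x (P 0))⁻¹ *ᵥ blockVec w 0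
    have h1 : D (i + 1) *ᵥ (evalMatrix x (P (i + 1)) *ᵥ u) =
        x • blockVec w i - E i *ᵥ blockVec w i -
          if i = 0 then 0 else (D i)ᴴ *ᵥ blockVec w (i - 1) := by
      have h2 := congrArg (evalMatrix x) (hP.constMatrix_mul_succ i)
      rw [map_mul, evalMatrix_constMatrix, map_sub, map_sub, evalMatrix_X_smul, map_mul,
        evalMatrix_constMatrix] at h2
      rw [Matrix.mulVec_mulVec, h2, Matrix.sub_mulVec, Matrix.sub_mulVec, Matrix.smul_mulVec,
        ← Matrix.mulVec_mulVec, ih i (by omega) (by omega)]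
      congr 1
      split_ifs with h
      · rw [map_zero, Matrix.zero_mulVec]
      · rw [map_mul, evalMatrix_constMatrix, ← Matrix.mulVec_mulVec,
          ih (i - 1) (by omega) (by omega)]
    have h2 := truncatedJacobi_mulVec D E w ⟨i, by omega⟩
    have h3 : (fun a => (truncatedJacobi D E n *ᵥ w) (⟨i, by omega⟩, a)) = x • blockVec w i := by
      ext a
      simp [hw, blockVec, show i < n + 1 by omega]
    rw [h3] at h2
    simp only at h2
    have h4 : D (i + 1) *ᵥ (evalMatrix x (P (i + 1)) *ᵥ u) =
        D (i + 1) *ᵥ blockVec w (i + 1) := by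
      rw [h1, h2]
      abel
    exact Matrix.mulVec_injective_iff_isUnit.2
      ((Matrix.isUnit_iff_isUnit_det _).2 (hP.det_ne_zero (i + 1) (by omega)).isUnit) h4

/-- Gauss quadrature: the eigenvalues and eigenvectors of the truncated block Jacobi matrix give
a discrete positive matrix of measures for which `P_0, …, P_n` are orthonormal. -/
theorem exists_quadrature (hP : MatrixRecurrence P D E) (n : ℕ) :
    ∃ (x : Fin (n + 1) × Fin N → ℝ) (u : Fin (n + 1) × Fin N → Fin N → ℂ),
      ∀ i ≤ n, ∀ j ≤ n, ∀ a b, ∑ t, (evalMatrix (x t) (P i) *ᵥ u t) a *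
        starRingEnd ℂ ((evalMatrix (x t) (P j) *ᵥ u t) b) =
          if i = j then (1 : Matrix (Fin N) (Fin N) ℂ) a b else 0 := by
  have hJ := truncatedJacobi_isHermitian (D := D) hP.hermitian n
  let w : Fin (n + 1) × Fin N → Fin (n + 1) × Fin N → ℂ := fun t => hJ.eigenvectorBasis t
  have hw : ∀ t, truncatedJacobi D E n *ᵥ w t = ((hJ.eigenvalues t : ℝ) : ℂ) • w t := fun t => by
    have := hJ.mulVec_eigenvectorBasis t
    rw [this]
    ext s
    simp [w]
  refine ⟨hJ.eigenvalues, fun t => (evalMatrix (hJ.eigenvalues t) (P 0))⁻¹ *ᵥ blockVec (w t) 0,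
    fun i hi j hj a b => ?_⟩
  simp only [hP.evalMatrix_mulVec_of_eigenvector (hw _) hi,
    hP.evalMatrix_mulVec_of_eigenvector (hw _) hj]
  have h1 := congrFun (congrFun (Matrix.mem_unitaryGroup_iff.1 hJ.eigenvectorUnitary.2)
    (⟨i, by omega⟩, a)) (⟨j, by omega⟩, b)
  simp only [Matrix.mul_apply, Matrix.star_apply, Matrix.one_apply, Prod.mk.injEq,
    Fin.mk.injEq] at h1 ⊢
  simp only [blockVec, show i < n + 1 by omega, show j < n + 1 by omega, dif_pos]
  refine Eq.trans ?_ (h1.trans ?_)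
  · rfl
  · by_cases h : i = j <;> simp [h]

end MatrixRecurrence

end Jacobi

/-! ### Matrices of measures with a rank one density -/

section Favard

variable {N : ℕ}

namespace PosDefMatrixMeasure

/-- The matrix of measures `B ↦ ∫_{x ∈ B} v v^* dμ(x, v)` given by a scalar measure `μ` on the
space of pairs `(x, v)` of a real number and a vector. -/
noncomputable def ofMeasure (μ : Measure (ℝ × (Fin N → ℂ)))
    (hμ : ∀ (q : ℂ[X]) (k l : Fin N), Integrable (fun z : ℝ × (Fin N → ℂ) =>
      q.eval (z.1 : ℂ) * (z.2 k * starRingEnd ℂ (z.2 l))) μ) : PosDefMatrixMeasure N where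
  entry k l := (μ.withDensityᵥ fun z => z.2 k * starRingEnd ℂ (z.2 l)).map Prod.fst
  posSemidef B hB := by
    have hint : ∀ k l : Fin N, Integrable (fun z : ℝ × (Fin N → ℂ) =>
        z.2 k * starRingEnd ℂ (z.2 l)) μ := fun k l => by simpa using hμ 1 k l
    have hentry : ∀ k l : Fin N,
        (μ.withDensityᵥ fun z => z.2 k * starRingEnd ℂ (z.2 l)).map Prod.fst B =
          ∫ z in Prod.fst ⁻¹' B, z.2 k * starRingEnd ℂ (z.2 l) ∂μ := fun k l => by
      rw [VectorMeasure.map_apply _ measurable_fst hB,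
        withDensityᵥ_apply (hint k l) (measurable_fst hB)]
    refine Matrix.PosSemidef.of_dotProduct_mulVec_nonneg ?_ fun y => ?_
    · refine Matrix.IsHermitian.ext fun k l => ?_
      simp only [Matrix.of_apply, hentry, RCLike.star_def]
      rw [← integral_conj]
      simp [mul_comm]
    · have hsum : star y ⬝ᵥ ((Matrix.of fun k l =>
          (μ.withDensityᵥ fun z => z.2 k * starRingEnd ℂ (z.2 l)).map Prod.fst B) *ᵥ y) =
          ∫ z in Prod.fst ⁻¹' B, ((‖∑ k, starRingEnd ℂ (y k) * z.2 k‖ ^ 2 : ℝ) : ℂ) ∂μ := by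
        simp only [dotProduct, Matrix.mulVec, Matrix.of_apply, hentry, Pi.star_apply,
          RCLike.star_def, Finset.mul_sum]
        have h1 : ∀ z : ℝ × (Fin N → ℂ),
            ((‖∑ k, starRingEnd ℂ (y k) * z.2 k‖ ^ 2 : ℝ) : ℂ) =
              ∑ k, ∑ l, starRingEnd ℂ (y k) * (y l) * (z.2 k * starRingEnd ℂ (z.2 l)) := by
          intro z
          push_cast
          rw [← Complex.mul_conj', map_sum, Finset.sum_mul_sum]
          refine Finset.sum_congr rfl fun k _ => Finset.sum_congr rfl fun l _ => ?_
          simp only [map_mul, Complex.conj_conj]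
          ring
        simp only [h1]
        rw [integral_finsetSum _ fun k _ => integrable_finsetSum _ fun l _ =>
          ((hint k l).const_mul _).integrableOn]
        refine Finset.sum_congr rfl fun k _ => ?_
        rw [integral_finsetSum _ fun l _ => ((hint k l).const_mul _).integrableOn]
        refine Finset.sum_congr rfl fun l _ => ?_
        rw [integral_const_mul]
        ring
      rw [hsum, integral_complex_ofReal]
      exact Complex.zero_le_real.2 (integral_nonneg fun z => sq_nonneg _)
  moments k l n := by
    refine VectorMeasure.Integrable.map (by fun_prop) ?_
    rw [ComplexMeasure.integrable_withDensityᵥ_iff (by simpa using hμ 1 k l) (by fun_prop)]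
    simpa using hμ (X ^ n) k l

theorem entry_ofMeasure (μ : Measure (ℝ × (Fin N → ℂ)))
    (hμ : ∀ (q : ℂ[X]) (k l : Fin N), Integrable (fun z : ℝ × (Fin N → ℂ) =>
      q.eval (z.1 : ℂ) * (z.2 k * starRingEnd ℂ (z.2 l))) μ) (k l : Fin N) :
    (ofMeasure μ hμ).entry k l =
      (μ.withDensityᵥ fun z => z.2 k * starRingEnd ℂ (z.2 l)).map Prod.fst := rfl

theorem inner_ofMeasure (μ : Measure (ℝ × (Fin N → ℂ)))
    (hμ : ∀ (q : ℂ[X]) (k l : Fin N), Integrable (fun z : ℝ × (Fin N → ℂ) =>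
      q.eval (z.1 : ℂ) * (z.2 k * starRingEnd ℂ (z.2 l))) μ)
    (P Q : Matrix (Fin N) (Fin N) ℂ[X]) (i j : Fin N) :
    (ofMeasure μ hμ).inner P Q i j = ∫ z, (evalMatrix z.1 P *ᵥ z.2) i *
      starRingEnd ℂ ((evalMatrix z.1 Q *ᵥ z.2) j) ∂μ := by
  have hint : ∀ k l : Fin N, Integrable (fun z : ℝ × (Fin N → ℂ) =>
      z.2 k * starRingEnd ℂ (z.2 l)) μ := fun k l => by simpa using hμ 1 k l
  have hint' : ∀ k l : Fin N, Integrable (fun z : ℝ × (Fin N → ℂ) =>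
      (P i k).eval (z.1 : ℂ) * starRingEnd ℂ ((Q j l).eval (z.1 : ℂ)) *
        (z.2 k * starRingEnd ℂ (z.2 l))) μ := fun k l => by
    simpa [eval_map_conj] using hμ (P i k * (Q j l).map (starRingEnd ℂ)) k l
  have h1 : ∀ z : ℝ × (Fin N → ℂ), (evalMatrix z.1 P *ᵥ z.2) i *
      starRingEnd ℂ ((evalMatrix z.1 Q *ᵥ z.2) j) =
      ∑ k, ∑ l, (P i k).eval (z.1 : ℂ) * starRingEnd ℂ ((Q j l).eval (z.1 : ℂ)) *
        (z.2 k * starRingEnd ℂ (z.2 l)) := by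
    intro z
    simp only [Matrix.mulVec, dotProduct, evalMatrix_apply, map_sum, Finset.sum_mul_sum, map_mul]
    refine Finset.sum_congr rfl fun k _ => Finset.sum_congr rfl fun l _ => ?_
    ring
  simp only [h1]
  rw [integral_finsetSum _ fun k _ => integrable_finsetSum _ fun l _ => hint' k l]
  simp only [inner, Matrix.of_apply]
  refine Finset.sum_congr rfl fun k _ => ?_
  rw [integral_finsetSum _ fun l _ => hint' k l]
  refine Finset.sum_congr rfl fun l _ => ?_
  have hi : (μ.withDensityᵥ fun z => z.2 k * starRingEnd ℂ (z.2 l)).Integrable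
      fun z : ℝ × (Fin N → ℂ) =>
        (P i k).eval (z.1 : ℂ) * starRingEnd ℂ ((Q j l).eval (z.1 : ℂ)) :=
    (ComplexMeasure.integrable_withDensityᵥ_iff (hint k l) (by fun_prop)).2 (hint' k l)
  have hc : Continuous fun x : ℝ =>
      (P i k).eval (x : ℂ) * starRingEnd ℂ ((Q j l).eval (x : ℂ)) :=
    ((P i k).continuous.comp Complex.continuous_ofReal).mul
      (Complex.continuous_conj.comp ((Q j l).continuous.comp Complex.continuous_ofReal))
  rw [entry_ofMeasure, VectorMeasure.integral_map measurable_fst hc.aestronglyMeasurable hi]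
  exact ComplexMeasure.integral_withDensityᵥ (hint k l) (by fun_prop) hi

end PosDefMatrixMeasure

/-! ### Favard's theorem -/

/-- The scalar measure on pairs `(x, v)` with which `PosDefMatrixMeasure.ofMeasure` encodes the
discrete matrix of measures `∑_t u_t u_t^* δ_{x_t}`: the mass `‖u_t‖²` is placed at
`(x_t, u_t / ‖u_t‖)`, with the maximum norm.  A vanishing `u_t` contributes nothing. -/
noncomputable def discreteMeasure {ι : Type*} [Fintype ι] (x : ι → ℝ) (u : ι → Fin N → ℂ) :
    FiniteMeasure (ℝ × (Fin N → ℂ)) :=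
  ⟨∑ t, (‖u t‖ₑ ^ 2) • Measure.dirac (x t, ((‖u t‖⁻¹ : ℝ) : ℂ) • u t), by
    refine ⟨?_⟩
    simp only [Measure.finsetSum_apply, Measure.smul_apply, measure_univ, smul_eq_mul, mul_one]
    exact ENNReal.sum_lt_top.2 fun t _ => ENNReal.pow_lt_top enorm_lt_top⟩

section DiscreteMeasure

variable {ι : Type*} [Fintype ι] (x : ι → ℝ) (u : ι → Fin N → ℂ)

theorem coe_discreteMeasure : (discreteMeasure x u : Measure (ℝ × (Fin N → ℂ))) =
    ∑ t, (‖u t‖ₑ ^ 2) • Measure.dirac (x t, ((‖u t‖⁻¹ : ℝ) : ℂ) • u t) := rfl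

theorem ae_discreteMeasure : ∀ᵐ z ∂(discreteMeasure x u : Measure (ℝ × (Fin N → ℂ))),
    ‖z.2‖ = 1 := by
  rw [ae_iff, coe_discreteMeasure, Measure.finsetSum_apply, Finset.sum_eq_zero]
  intro t _
  rcases eq_or_ne (u t) 0 with h | h
  · simp [h]
  · have hs : MeasurableSet {z : ℝ × (Fin N → ℂ) | ¬ ‖z.2‖ = 1} :=
      (measurableSet_eq_fun (by fun_prop) measurable_const).compl
    rw [Measure.smul_apply, Measure.dirac_apply' _ hs, Set.indicator_of_notMem, smul_zero]
    have : ‖u t‖ ≠ 0 := norm_ne_zero_iff.2 h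
    simp [norm_smul, this]

/-- For `v = 0` both sides vanish, so the junk value of `‖v‖⁻¹` is harmless. -/
theorem smul_mulVec_normalize (A : Matrix (Fin N) (Fin N) ℂ) (v : Fin N → ℂ) (a : Fin N) :
    (‖v‖ : ℂ) * (A *ᵥ (((‖v‖⁻¹ : ℝ) : ℂ) • v)) a = (A *ᵥ v) a := by
  rcases eq_or_ne v 0 with h | h
  · simp [h]
  · have : (‖v‖ : ℂ) ≠ 0 := by exact_mod_cast norm_ne_zero_iff.2 h
    rw [Matrix.mulVec_smul, Pi.smul_apply, smul_eq_mul, ← mul_assoc, Complex.ofReal_inv,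
      mul_inv_cancel₀ this, one_mul]

theorem continuous_evalMatrix_mulVec (P : Matrix (Fin N) (Fin N) ℂ[X]) (a : Fin N) :
    Continuous fun z : ℝ × (Fin N → ℂ) => (evalMatrix z.1 P *ᵥ z.2) a := by
  simp only [Matrix.mulVec, dotProduct, evalMatrix_apply]
  refine continuous_finsetSum _ fun b _ => ?_
  exact ((P a b).continuous.comp (Complex.continuous_ofReal.comp continuous_fst)).mul (by fun_prop)

theorem lintegral_discreteMeasure (P : Matrix (Fin N) (Fin N) ℂ[X]) (a : Fin N) :
    ∫⁻ z, ‖(evalMatrix z.1 P *ᵥ z.2) a‖ₑ ^ 2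
      ∂(discreteMeasure x u : Measure (ℝ × (Fin N → ℂ))) =
      ∑ t, ‖(evalMatrix (x t) P *ᵥ u t) a‖ₑ ^ 2 := by
  rw [coe_discreteMeasure, lintegral_finsetSum_measure]
  refine Finset.sum_congr rfl fun t _ => ?_
  rw [lintegral_smul_measure, lintegral_dirac' _
    ((continuous_evalMatrix_mulVec P a).enorm.measurable.pow_const 2), smul_eq_mul, ← mul_pow,
    ← smul_mulVec_normalize _ (u t), enorm_mul]
  simp [enorm_eq_nnnorm]

theorem integral_discreteMeasure (P Q : Matrix (Fin N) (Fin N) ℂ[X]) (a b : Fin N) :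
    ∫ z, (evalMatrix z.1 P *ᵥ z.2) a * starRingEnd ℂ ((evalMatrix z.1 Q *ᵥ z.2) b)
      ∂(discreteMeasure x u : Measure (ℝ × (Fin N → ℂ))) =
      ∑ t, (evalMatrix (x t) P *ᵥ u t) a * starRingEnd ℂ ((evalMatrix (x t) Q *ᵥ u t) b) := by
  have hc : Continuous fun z : ℝ × (Fin N → ℂ) =>
      (evalMatrix z.1 P *ᵥ z.2) a * starRingEnd ℂ ((evalMatrix z.1 Q *ᵥ z.2) b) :=
    (continuous_evalMatrix_mulVec P a).mul
      (Complex.continuous_conj.comp (continuous_evalMatrix_mulVec Q b))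
  rw [coe_discreteMeasure, integral_finsetSum_measure fun t _ =>
    (integrable_dirac' hc.stronglyMeasurable enorm_lt_top).smul_measure (by simp)]
  refine Finset.sum_congr rfl fun t _ => ?_
  rw [integral_smul_measure, integral_dirac' _ _ hc.stronglyMeasurable,
    ← smul_mulVec_normalize _ (u t), ← smul_mulVec_normalize (evalMatrix (x t) Q) (u t)]
  simp only [ENNReal.toReal_pow, toReal_enorm, Complex.real_smul, map_mul, Complex.conj_ofReal]
  push_cast
  ring

end DiscreteMeasure

/-- Favard's theorem: the quadrature matrices of measures of `MatrixRecurrence.exists_quadrature`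
have a weak limit point, for which all the `P_n` are orthonormal.  Every matrix polynomial is a
combination of the `P_i`, so the functions `(x, v) ↦ (Q(x) v)_a` are bounded in `L²` of the
discrete measures, uniformly for large `n`; this gives the tightness and the convergence of the
moments. -/
theorem MatrixRecurrence.exists_isOrthonormal {P : ℕ → Matrix (Fin N) (Fin N) ℂ[X]}
    {D E : ℕ → Matrix (Fin N) (Fin N) ℂ} (hP : MatrixRecurrence P D E) :
    ∃ M : PosDefMatrixMeasure N, IsOrthonormal M P := by
  choose x u hxu using hP.exists_quadrature
  set ν : ℕ → FiniteMeasure (ℝ × (Fin N → ℂ)) := fun n => discreteMeasure (x n) (u n)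
  have hν1 : ∀ n, ∀ᵐ z ∂(ν n : Measure (ℝ × (Fin N → ℂ))), ‖z.2‖ = 1 :=
    fun n => ae_discreteMeasure _ _
  have hbasis : ∀ i a, L2Bounded ν fun z => (evalMatrix z.1 (P i) *ᵥ z.2) a := by
    refine fun i a => ⟨continuous_evalMatrix_mulVec _ _, 1, ?_⟩
    filter_upwards [Filter.eventually_ge_atTop i] with n hn
    have h1 : ∑ t, ‖(evalMatrix (x n t) (P i) *ᵥ u n t) a‖ ^ 2 = 1 := by
      have h2 := hxu n i hn i hn a a
      simp only [Complex.mul_conj', if_true, Matrix.one_apply_eq] at h2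
      exact_mod_cast h2
    rw [lintegral_discreteMeasure]
    simp only [← ofReal_norm, ← ENNReal.ofReal_pow (norm_nonneg _)]
    rw [← ENNReal.ofReal_sum_of_nonneg fun t _ => sq_nonneg _, h1]
    simp
  -- every matrix polynomial `Q` is a combination of the `P_i`
  have hall : ∀ (Q : Matrix (Fin N) (Fin N) ℂ[X]) a,
      L2Bounded ν fun z => (evalMatrix z.1 Q *ᵥ z.2) a := by
    intro Q a
    obtain ⟨d, hd⟩ : ∃ d, ∀ i j, (Q i j).natDegree ≤ d :=
      ⟨Finset.univ.sup fun i => Finset.univ.sup fun j => (Q i j).natDegree, fun i j =>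
        (Finset.le_sup (f := fun j => (Q i j).natDegree) (Finset.mem_univ j)).trans
          (Finset.le_sup (f := fun i => Finset.univ.sup fun j => (Q i j).natDegree)
            (Finset.mem_univ i))⟩
    obtain ⟨c, hc⟩ := exists_eq_sum_constMatrix_mul (d + 1)
      (fun i _ k hk => hP.matCoeff_eq_zero hk) (fun i _ => hP.det_matCoeff_ne_zero i) Q
      (fun k hk => natDegree_le_iff_matCoeff.1 hd k hk)
    have h1 : ∀ z : ℝ × (Fin N → ℂ), (evalMatrix z.1 Q *ᵥ z.2) a =
        ∑ i ∈ Finset.range (d + 1), ∑ b, c i a b * (evalMatrix z.1 (P i) *ᵥ z.2) b := by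
      intro z
      conv_lhs => rw [hc]
      rw [map_sum, Matrix.sum_mulVec, Finset.sum_apply]
      refine Finset.sum_congr rfl fun i _ => ?_
      rw [map_mul, evalMatrix_constMatrix, ← Matrix.mulVec_mulVec]
      rfl
    simp only [h1]
    exact L2Bounded.sum fun i _ => L2Bounded.sum fun b _ => (hbasis i b).const_mul _
  have hpoly : ∀ (q : ℂ[X]) (k : Fin N),
      L2Bounded ν fun z : ℝ × (Fin N → ℂ) => q.eval (z.1 : ℂ) * z.2 k := by
    intro q k
    have h1 : ∀ z : ℝ × (Fin N → ℂ), (evalMatrix z.1 (q • 1) *ᵥ z.2) k =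
        q.eval (z.1 : ℂ) * z.2 k := by
      intro z
      have : evalMatrix (z.1 : ℂ) (q • (1 : Matrix (Fin N) (Fin N) ℂ[X])) =
          q.eval (z.1 : ℂ) • 1 := by
        ext i j
        by_cases h : i = j <;> simp [evalMatrix_apply, h]
      rw [this, Matrix.smul_mulVec, Matrix.one_mulVec]
      rfl
    simpa only [h1] using hall (q • 1) k
  have hprod : ∀ (q : ℂ[X]) (k l : Fin N), L2Bounded ν fun z : ℝ × (Fin N → ℂ) =>
      q.eval (z.1 : ℂ) * (z.2 k * starRingEnd ℂ (z.2 l)) := by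
    intro q k l
    -- the additional factor `conj v_l` has modulus at most one almost everywhere
    refine (hpoly q k).mono ?_ fun n => ?_
    · exact (q.continuous.comp (Complex.continuous_ofReal.comp continuous_fst)).mul (by fun_prop)
    · filter_upwards [hν1 n] with z hz
      rw [← mul_assoc, norm_mul, RCLike.norm_conj]
      exact mul_le_of_le_one_right (norm_nonneg _) (hz ▸ norm_le_pi_norm z.2 l)
  -- since `‖v‖ = 1` almost everywhere, bounds for `v` and `x v` are bounds for the mass and `x`
  have hsnd : L2Bounded ν fun z : ℝ × (Fin N → ℂ) => z.2 :=
    L2Bounded.pi fun k => by simpa using hpoly 1 k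
  have hfst : L2Bounded ν fun z : ℝ × (Fin N → ℂ) => (z.1 : ℂ) • z.2 :=
    L2Bounded.pi fun k => by simpa using hpoly X k
  have hone : L2Bounded ν fun _ => (1 : ℝ) := by
    refine hsnd.mono continuous_const fun n => ?_
    filter_upwards [hν1 n] with z hz
    simp [hz]
  have hnorm : L2Bounded ν fun z : ℝ × (Fin N → ℂ) => ‖z‖ := by
    have hfst' : L2Bounded ν fun z : ℝ × (Fin N → ℂ) => ‖z.1‖ := by
      refine hfst.mono (by fun_prop) fun n => ?_
      filter_upwards [hν1 n] with z hz
      simp [norm_smul, hz]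
    refine (hfst'.add hone).mono (by fun_prop) fun n => ?_
    filter_upwards [hν1 n] with z hz
    rw [norm_norm, Prod.norm_def, hz, Real.norm_of_nonneg (show 0 ≤ ‖z.1‖ + 1 by positivity)]
    exact max_le (by simp) (by simp)
  obtain ⟨μ, hμ⟩ := exists_weak_limit hone hnorm
  refine ⟨PosDefMatrixMeasure.ofMeasure (μ : Measure (ℝ × (Fin N → ℂ)))
    fun q k l => (hμ _ (hprod q k l)).1, hP.natDegree_le, fun n m => ?_⟩
  ext i j
  rw [PosDefMatrixMeasure.inner_ofMeasure]
  have hb : L2Bounded ν fun z : ℝ × (Fin N → ℂ) => (evalMatrix z.1 (P n) *ᵥ z.2) i *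
      starRingEnd ℂ ((evalMatrix z.1 (P m) *ᵥ z.2) j) := by
    have h1 : ∀ z : ℝ × (Fin N → ℂ), (evalMatrix z.1 (P n) *ᵥ z.2) i *
        starRingEnd ℂ ((evalMatrix z.1 (P m) *ᵥ z.2) j) =
        ∑ k, ∑ l, (P n i k * (P m j l).map (starRingEnd ℂ)).eval (z.1 : ℂ) *
          (z.2 k * starRingEnd ℂ (z.2 l)) := by
      intro z
      simp only [Matrix.mulVec, dotProduct, evalMatrix_apply, map_sum, Finset.sum_mul_sum,
        map_mul, eval_mul, PosDefMatrixMeasure.eval_map_conj]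
      refine Finset.sum_congr rfl fun k _ => Finset.sum_congr rfl fun l _ => ?_
      ring
    simp only [h1]
    exact L2Bounded.sum fun k _ => L2Bounded.sum fun l _ => hprod _ k l
  have hlim := (hμ _ hb).2 (if n = m then (1 : Matrix (Fin N) (Fin N) ℂ) i j else 0) (by
    filter_upwards [Filter.eventually_ge_atTop (max n m)] with r hr
    rw [integral_discreteMeasure]
    exact hxu r n (le_of_max_le_left hr) m (le_of_max_le_right hr) i j)
  rw [hlim]
  split_ifs <;> rfl

end Favard

/-! ### The correspondence between scalar and matrix recurrences -/

theorem mainTheorem1 (N : ℕ) [NeZero N] (h : ℂ[X]) (hh : h.natDegree = N) :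
    -- from scalar polynomials to matrix polynomials
    (∀ (c : ℕ → ℕ → ℂ) (p : ℕ → ℂ[X]), ScalarRecurrence N h c p →
      (∀ n, (p n).degree = n) ∧
      MatrixRecurrence (toMatrixPolys N h p) (blockD N c) (blockE N c) ∧
      (∀ n, 1 ≤ n → (blockD N c n).IsLowerTriangular) ∧
      (∀ n, (matCoeff n (toMatrixPolys N h p n)).IsLowerTriangular ∧
        (matCoeff n (toMatrixPolys N h p n)).det ≠ 0) ∧
      ∃ M : PosDefMatrixMeasure N, IsOrthonormal M (toMatrixPolys N h p)) ∧
    -- orthonormality is equivalent to a matrix three-term recurrence relation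
    (∀ P : ℕ → Matrix (Fin N) (Fin N) ℂ[X],
      (∃ M : PosDefMatrixMeasure N, IsOrthonormal M P) ↔ ∃ D E, MatrixRecurrence P D E) ∧
    -- the normalization to lower triangular leading coefficients
    (∀ (M : PosDefMatrixMeasure N) (Q : ℕ → Matrix (Fin N) (Fin N) ℂ[X])
      (A B : ℕ → Matrix (Fin N) (Fin N) ℂ), IsOrthonormal M Q → MatrixRecurrence Q A B →
      ∃ U : ℕ → Matrix (Fin N) (Fin N) ℂ, (∀ n, U n ∈ Matrix.unitaryGroup (Fin N) ℂ) ∧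
        IsOrthonormal M (fun n => constMatrix (U n) * Q n) ∧
        (∀ n, (matCoeff n (constMatrix (U n) * Q n)).IsLowerTriangular) ∧
        (∀ n, 1 ≤ n → (U (n - 1) * A n * (U n)ᴴ).IsLowerTriangular) ∧
        MatrixRecurrence (fun n => constMatrix (U n) * Q n)
          (fun n => U (n - 1) * A n * (U n)ᴴ) (fun n => U n * B n * (U n)ᴴ)) ∧
    -- from matrix polynomials to scalar polynomials
    (∀ P : ℕ → Matrix (Fin N) (Fin N) ℂ[X],
      (∀ n, (matCoeff n (P n)).IsLowerTriangular) →
      (∀ M : PosDefMatrixMeasure N, IsOrthonormal M P →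
        (∀ n, (toScalarPolys h P n).degree = n) ∧
        ∃ c, ScalarRecurrence N h c (toScalarPolys h P)) ∧
      (∀ D E : ℕ → Matrix (Fin N) (Fin N) ℂ, MatrixRecurrence P D E →
        (∀ n, 1 ≤ n → (D n).IsLowerTriangular) ∧
        (∀ n, (toScalarPolys h P n).degree = n) ∧
        ∃ c, ScalarRecurrence N h c (toScalarPolys h P) ∧
          (∀ n, 1 ≤ n → blockD N c n = D n) ∧ (∀ n, blockE N c n = E n))) := by
  have hfavard : ∀ P : ℕ → Matrix (Fin N) (Fin N) ℂ[X],
      (∃ M : PosDefMatrixMeasure N, IsOrthonormal M P) ↔ ∃ D E, MatrixRecurrence P D E :=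
    fun P => ⟨fun ⟨_, hP⟩ => ⟨_, _, hP.matrixRecurrence⟩,
      fun ⟨_, _, hP⟩ => hP.exists_isOrthonormal⟩
  have hscalar : ∀ (P : ℕ → Matrix (Fin N) (Fin N) ℂ[X])
      (D E : ℕ → Matrix (Fin N) (Fin N) ℂ), MatrixRecurrence P D E →
      (∀ n, (matCoeff n (P n)).IsLowerTriangular) →
      (∀ n, (toScalarPolys h P n).degree = n) ∧
        ScalarRecurrence N h (bandCoeff D E) (toScalarPolys h P) := fun P D E hP hL =>
    ⟨(hP.scalarRecurrence hh hL).degree_eq hh (NeZero.pos N), hP.scalarRecurrence hh hL⟩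
  refine ⟨fun c p hp => ?_, hfavard, fun M Q A B hQ hQ' => ?_, fun P hL => ⟨fun M hP => ?_,
    fun D E hP => ?_⟩⟩
  · have hP := hp.matrixRecurrence hh
    exact ⟨hp.degree_eq hh (NeZero.pos N), hP, fun n _ => blockD_isLowerTriangular c n,
      fun n => ⟨hp.matCoeff_isLowerTriangular hh n, hP.det_matCoeff_ne_zero n⟩,
      hP.exists_isOrthonormal⟩
  · choose U hU hUL using fun n => exists_unitary_mul_isLowerTriangular (matCoeff n (Q n))
    have hUL' : ∀ n, (matCoeff n (constMatrix (U n) * Q n)).IsLowerTriangular := fun n => by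
      rw [matCoeff_constMatrix_mul]
      exact hUL n
    have hrec := hQ'.unitary_mul hU
    exact ⟨U, hU, hQ.unitary_mul hU, hUL',
      fun n hn => hrec.isLowerTriangular_of_matCoeff hUL' hn, hrec⟩
  · obtain ⟨hdeg, hrec⟩ := hscalar P _ _ hP.matrixRecurrence hL
    exact ⟨hdeg, _, hrec⟩
  · have hD := fun n hn => hP.isLowerTriangular_of_matCoeff hL (n := n) hn
    obtain ⟨hdeg, hrec⟩ := hscalar P D E hP hL
    exact ⟨hD, hdeg, _, hrec, fun n hn => blockD_bandCoeff hn (hD n hn),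
      fun n => blockE_bandCoeff (hP.hermitian n)⟩
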